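/- **Proposition (Oja's method).** Let $\tau,\omega>0$, $\rho\in(0,1]$, and let $\pi=(1-\rho)\delta_0+\rho\,u$, where $u$ is a probability measure on $\mathbb R$ with $\int x^2\,du(x)=1/\rho$. For every dimension $p$, let $\xi\in\mathbb R^p$ be a random vector with i.i.d. entries of law $\pi$, let $x_0\in\mathbb R^p$ be a random initial estimate (possibly dependent on $\xi$), and for $k\ge 1$ let $$y_k=\sqrt{\omega/p}\;c_k\,\xi+a_k,\qquad c_k\sim\mathcal N(0,1),\quad a_k\sim\mathcal N(0,I_p),$$ where $c_k$ and $a_k$ are independent and the pairs $(c_k,a_k)$, $k\ge1$, are independent of each other and of $(x_0,\xi)$. Oja's method is the recursion $$\tilde x_k=x_{k-1}+\frac{\tau}{p}\,y_ky_k^Tx_{k-1},\qquad x_k=\sqrt p\,\frac{\tilde x_k}{\|\tilde x_k\|}.$$ Let $Q_t^p=\dfrac{x_k^T\xi}{\|x_k\|\,\|\xi\|}$ with $k=\lfloor pt\rfloor$, for $t\ge0$ (set to $0$ if a vector in the denominator vanishes). Put $\alpha_1=\tau\omega(1+\tau/2)$ and $\alpha_2=\tau(\omega-\tau/2)$, and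 assume that $Q_0^p\to Q_0$ in probability as $p\to\infty$, where $Q_0\neq0$ is a deterministic constant. Then the initial value problem $$\frac{dQ_t}{dt}=-\alpha_1Q_t^3+\alpha_2Q_t,\quad t\ge 0,\qquad Q_t|_{t=0}=Q_0,$$ has a unique solution $Q_t$ on $[0,\infty)$; it satisfies, for all $t\ge 0$, $$Q_t^2=\begin{cases}\alpha_2\Big[\alpha_1+\Big(\dfrac{\alpha_2}{Q_0^2}-\alpha_1\Big)e^{-2\alpha_2t}\Big]^{-1}&\text{if }\alpha_2\ne0,\\[2mm] \big(2\alpha_1t+Q_0^{-2}\big)^{-1}&\text{if }\alpha_2=0;\end{cases}$$ and the process $Q^p_t$ converges to $Q_t$ in probability, uniformly on compact time intervals: for all $T>0$ and $\varepsilon>0$, $$\lim_{p\to\infty}\mathbb P\Big(\text{there is } t\in[0,T]\text{ with }|Q_t^p-Q_t|\ge\varepsilon\Big)=0.$$ -/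

import Mathlib

open MeasureTheory ProbabilityTheory Filter Topology

noncomputable section

/-- The mixture prior `(1 - ρ) δ₀ + ρ u` of the entries of the unknown vector. -/
def sparsePrior (ρ : ℝ) (u : Measure ℝ) : Measure ℝ :=
  ENNReal.ofReal (1 - ρ) • Measure.dirac 0 + ENNReal.ofReal ρ • u

/-- A sample of the spiked covariance model in dimension `p`:
`y = √(ω / p) c ξ + a`. -/
def spikedSample (p : ℕ) (ω : ℝ) (ξ : EuclideanSpace ℝ (Fin p)) (c : ℝ)
    (a : EuclideanSpace ℝ (Fin p)) : EuclideanSpace ℝ (Fin p) :=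
  (Real.sqrt (ω / p) * c) • ξ + a

/-- The element-wise nonlinearity `η(x) = x - φ(x) / p`. -/
def etaMap (p : ℕ) (φ : ℝ → ℝ) (x : EuclideanSpace ℝ (Fin p)) : EuclideanSpace ℝ (Fin p) :=
  WithLp.toLp 2 (fun i => x i - 1 / (p : ℝ) * φ (x i))

/-- One step of the online algorithm with step size `τ`, nonlinearity `φ` and sample `y`:
`x̃ = x + (τ / p) y yᵀ x`, followed by `√p η(x̃) / ‖η(x̃)‖`. -/
def onlineStep (p : ℕ) (τ : ℝ) (φ : ℝ → ℝ) (y x : EuclideanSpace ℝ (Fin p)) :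
    EuclideanSpace ℝ (Fin p) :=
  (Real.sqrt p / ‖etaMap p φ (x + (τ / p * inner ℝ y x) • y)‖) •
    etaMap p φ (x + (τ / p * inner ℝ y x) • y)

/-- The iterates of the online algorithm started at `x₀`; `y k` is the `(k + 1)`-st sample. -/
def onlineIter (p : ℕ) (τ : ℝ) (φ : ℝ → ℝ) (y : ℕ → EuclideanSpace ℝ (Fin p))
    (x₀ : EuclideanSpace ℝ (Fin p)) : ℕ → EuclideanSpace ℝ (Fin p)
  | 0 => x₀
  | k + 1 => onlineStep p τ φ (y k) (onlineIter p τ φ y x₀ k)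

/-- Oja's method: the online algorithm with `φ = 0`. -/
def ojaIter (p : ℕ) (τ : ℝ) (y : ℕ → EuclideanSpace ℝ (Fin p))
    (x₀ : EuclideanSpace ℝ (Fin p)) : ℕ → EuclideanSpace ℝ (Fin p) :=
  onlineIter p τ (fun _ => 0) y x₀

/-- The cosine similarity `xᵀ ξ / (‖x‖ ‖ξ‖)` (equal to `0` if one of the vectors vanishes). -/
def cosineSim {p : ℕ} (x ξ : EuclideanSpace ℝ (Fin p)) : ℝ :=
  inner ℝ x ξ / (‖x‖ * ‖ξ‖)

/-- The probabilistic setting in dimension `p`: the entries of `ξ` are i.i.d. with law `π`; the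
noises satisfy `c k ∼ N(0, 1)`, `a k ∼ N(0, I_p)`, with `c k` and `a k` independent, and the pairs
`(c k, a k)` are independent over `k` and of the pair formed by the initial estimate `x₀` and `ξ`
(`x₀` and `ξ` may be dependent). -/
structure IsSpikedModel {Ω : Type*} [MeasurableSpace Ω] (P : Measure Ω) (p : ℕ) (π : Measure ℝ)
    (ξ x₀ : Ω → EuclideanSpace ℝ (Fin p)) (c : ℕ → Ω → ℝ)
    (a : ℕ → Ω → EuclideanSpace ℝ (Fin p)) : Prop where
  measurable_ξ : Measurable ξ
  measurable_x₀ : Measurable x₀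
  measurable_c : ∀ k, Measurable (c k)
  measurable_a : ∀ k, Measurable (a k)
  ξ_law : ∀ i, P.map (fun s => ξ s i) = π
  ξ_indep : iIndepFun (fun (i : Fin p) s => ξ s i) P
  c_law : ∀ k, P.map (c k) = gaussianReal 0 1
  a_law : ∀ k, P.map (a k) = stdGaussian (EuclideanSpace ℝ (Fin p))
  c_a_indep : ∀ k, IndepFun (c k) (a k) P
  noise_indep : iIndepFun (fun k s => (c k s, a k s)) P
  init_indep : IndepFun (fun s => (x₀ s, ξ s)) (fun s k => (c k s, a k s)) P

/-- The cosine similarity process of Oja's method in continuous time: the cosine similarity of `ξ`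
and the iterate number `⌊p t⌋` of the algorithm run on the spiked samples. -/
def ojaCosine (p : ℕ) (τ ω : ℝ) (ξ x₀ : EuclideanSpace ℝ (Fin p)) (c : ℕ → ℝ)
    (a : ℕ → EuclideanSpace ℝ (Fin p)) (t : ℝ) : ℝ :=
  cosineSim (ojaIter p τ (fun k => spikedSample p ω ξ (c k) (a k)) x₀ ⌊(p : ℝ) * t⌋₊) ξ

/-- `q` solves `dq/dt = -α₁ q³ + α₂ q` on `[0, ∞)` with initial value `q₀`. -/
def SolvesOjaODE (α₁ α₂ q₀ : ℝ) (q : ℝ → ℝ) : Prop :=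
  q 0 = q₀ ∧
    ∀ t, 0 ≤ t → HasDerivWithinAt q (-α₁ * q t ^ 3 + α₂ * q t) (Set.Ici 0) t

end

/-!
The cosine similarity `q` of Oja's iterate with the signal depends on the iterate through its
direction only, and it is a Markov chain once the signal is fixed. Let `s`, `b` be the scalar
products of the sample `y` with the unit vectors along the iterate and the signal, and let
`N = ‖y‖ ^ 2 / p`. One step sends `q` to
`(q + (τ / p) s b) / √(1 + (s ^ 2 / p) (2 τ + τ ^ 2 N))` (`cosineSim_ojaStep`).
Expanding to second order and using `E s b ≈ (ω + 1) q`, `E s ^ 2 ≈ ω q ^ 2 + 1` and `N ≈ 1`, the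
mean increment is `(-α₁ q ^ 3 + α₂ q) / p` up to an error `o(1 / p)`, and the mean square increment
is `O(1 / p ^ 2)`, uniformly in the iterate (`StepNoise.abs_integral_noisyCosine_sub_le`,
`StepNoise.integral_noisyCosine_sub_sq_le`). The Gaussian moments enter through
`stepNoise_noiseLaw`, and `‖ξ‖ ^ 2 / p → 1` is the law of large numbers
(`tendsto_measure_norm_sq_div_sub_one`).

The squared distance `V k = (q k - Q (k / p)) ^ 2` to the solution `Q` of the differential equation
is therefore a Lyapunov function. The drift is one-sided Lipschitz because its cubic part is
decreasing (`drift_oneSided_lipschitz`), so the conditional mean of `V (k + 1)` is at most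
`(1 + B / p) V k + κ / p`, where `κ` is small for large `p` (`exists_lyapunov_step`). A maximal
inequality for such almost supermartingales (`maximal_inequality`) bounds the probability that `V`
exceeds a fixed level before time `p T`, which gives uniform convergence at the grid times
`k / p` (`exists_run_bound`) and, `Q` being Lipschitz on `[0, T]`, on the whole interval.

The differential equation becomes linear in `z = 1 / Q ^ 2`, which gives the closed form
(`limitCosine_sq_eq`); uniqueness again follows from the one-sided Lipschitz bound
(`SolvesOjaODE.unique`).
-/

noncomputable section

/-! ### The limiting differential equation -/

/-- The solution of `φ' = 1 - 2 α φ`, `φ 0 = 0`. -/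
def relaxation (α t : ℝ) : ℝ :=
  if α = 0 then t else (1 - Real.exp (-2 * α * t)) / (2 * α)

lemma hasDerivAt_exp_neg_two_mul (α t : ℝ) :
    HasDerivAt (fun t => Real.exp (-2 * α * t)) (-2 * α * Real.exp (-2 * α * t)) t := by
  have h : HasDerivAt (fun t : ℝ => -2 * α * t) (-2 * α) t := by
    simpa using (hasDerivAt_id t).const_mul (-2 * α)
  simpa [mul_comm] using h.exp

lemma hasDerivAt_relaxation (α t : ℝ) :
    HasDerivAt (relaxation α) (1 - 2 * α * relaxation α t) t := by
  unfold relaxation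
  split_ifs with h
  · simpa [h] using hasDerivAt_id' t
  · have := ((hasDerivAt_exp_neg_two_mul α t).const_sub 1).div_const (2 * α)
    refine this.congr_deriv ?_
    field_simp
    ring

lemma relaxation_zero (α : ℝ) : relaxation α 0 = 0 := by simp [relaxation]

lemma relaxation_nonneg (α : ℝ) {t : ℝ} (ht : 0 ≤ t) : 0 ≤ relaxation α t := by
  unfold relaxation
  split_ifs with h
  · exact ht
  · rcases lt_or_gt_of_ne h with h | h
    · apply div_nonneg_of_nonpos _ (by linarith)
      have : 1 ≤ Real.exp (-2 * α * t) := Real.one_le_exp (by nlinarith)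
      linarith
    · apply div_nonneg _ (by linarith)
      have : Real.exp (-2 * α * t) ≤ 1 := Real.exp_le_one_iff.2 (by nlinarith)
      linarith

/-- The inverse square `1 / Q t ^ 2` of the limiting cosine similarity. The substitution
`z = 1 / Q ^ 2` turns `Q' = -α₁ Q ^ 3 + α₂ Q` into the linear equation `z' = 2 α₁ - 2 α₂ z`. -/
def invSqLimit (α₁ α₂ q₀ t : ℝ) : ℝ :=
  (q₀ ^ 2)⁻¹ * Real.exp (-2 * α₂ * t) + 2 * α₁ * relaxation α₂ t

/-- The limiting cosine similarity, as the root of `1 / invSqLimit` with the sign of `q₀`. -/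
def limitCosine (α₁ α₂ q₀ t : ℝ) : ℝ :=
  SignType.sign q₀ * (Real.sqrt (invSqLimit α₁ α₂ q₀ t))⁻¹

lemma hasDerivAt_invSqLimit (α₁ α₂ q₀ t : ℝ) :
    HasDerivAt (invSqLimit α₁ α₂ q₀) (2 * α₁ - 2 * α₂ * invSqLimit α₁ α₂ q₀ t) t := by
  have := ((hasDerivAt_exp_neg_two_mul α₂ t).const_mul (q₀ ^ 2)⁻¹).add
    ((hasDerivAt_relaxation α₂ t).const_mul (2 * α₁))
  refine this.congr_deriv ?_
  unfold invSqLimit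
  ring

lemma invSqLimit_pos {α₁ q₀ : ℝ} (α₂ : ℝ) (hα₁ : 0 < α₁) (hq : q₀ ≠ 0) {t : ℝ} (ht : 0 ≤ t) :
    0 < invSqLimit α₁ α₂ q₀ t := by
  have := relaxation_nonneg α₂ ht
  unfold invSqLimit
  positivity

lemma sign_sq_of_ne {q : ℝ} (hq : q ≠ 0) : ((SignType.sign q : ℝ)) ^ 2 = 1 := by
  rcases lt_or_gt_of_ne hq with h | h <;> simp [h]

lemma limitCosine_sq {α₁ q₀ : ℝ} (α₂ : ℝ) (hα₁ : 0 < α₁) (hq : q₀ ≠ 0) {t : ℝ} (ht : 0 ≤ t) :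
    limitCosine α₁ α₂ q₀ t ^ 2 = (invSqLimit α₁ α₂ q₀ t)⁻¹ := by
  rw [limitCosine, mul_pow, sign_sq_of_ne hq, one_mul, inv_pow,
    Real.sq_sqrt (invSqLimit_pos α₂ hα₁ hq ht).le]

lemma limitCosine_zero (α₁ α₂ q₀ : ℝ) : limitCosine α₁ α₂ q₀ 0 = q₀ := by
  simp only [limitCosine, invSqLimit, relaxation_zero, mul_zero, Real.exp_zero, mul_one, add_zero,
    Real.sqrt_inv, Real.sqrt_sq_eq_abs, inv_inv]
  exact sign_mul_abs q₀

lemma hasDerivAt_limitCosine {α₁ q₀ : ℝ} (α₂ : ℝ) (hα₁ : 0 < α₁) (hq : q₀ ≠ 0) {t : ℝ}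
    (ht : 0 ≤ t) :
    HasDerivAt (limitCosine α₁ α₂ q₀)
      (-α₁ * limitCosine α₁ α₂ q₀ t ^ 3 + α₂ * limitCosine α₁ α₂ q₀ t) t := by
  have hz := invSqLimit_pos α₂ hα₁ hq ht
  have hs : Real.sqrt (invSqLimit α₁ α₂ q₀ t) ≠ 0 := (Real.sqrt_pos.2 hz).ne'
  have h := ((((hasDerivAt_invSqLimit α₁ α₂ q₀ t).sqrt hz.ne').inv hs).const_mul
    ((SignType.sign q₀ : ℝ)))
  refine h.congr_deriv ?_
  have h3 : limitCosine α₁ α₂ q₀ t ^ 3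
      = (invSqLimit α₁ α₂ q₀ t)⁻¹ * limitCosine α₁ α₂ q₀ t := by
    rw [← limitCosine_sq α₂ hα₁ hq ht]; ring
  rw [h3]
  unfold limitCosine
  set z := invSqLimit α₁ α₂ q₀ t
  have hz2 : Real.sqrt z ^ 2 = z := Real.sq_sqrt hz.le
  rw [hz2]
  field_simp
  ring

lemma solvesOjaODE_limitCosine {α₁ q₀ : ℝ} (α₂ : ℝ) (hα₁ : 0 < α₁) (hq : q₀ ≠ 0) :
    SolvesOjaODE α₁ α₂ q₀ (limitCosine α₁ α₂ q₀) :=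
  ⟨limitCosine_zero α₁ α₂ q₀, fun _ ht => (hasDerivAt_limitCosine α₂ hα₁ hq ht).hasDerivWithinAt⟩

lemma limitCosine_sq_eq {α₁ q₀ : ℝ} (α₂ : ℝ) (hα₁ : 0 < α₁) (hq : q₀ ≠ 0) {t : ℝ} (ht : 0 ≤ t) :
    limitCosine α₁ α₂ q₀ t ^ 2 =
      if α₂ ≠ 0 then α₂ * (α₁ + (α₂ / q₀ ^ 2 - α₁) * Real.exp (-2 * α₂ * t))⁻¹
      else (2 * α₁ * t + (q₀ ^ 2)⁻¹)⁻¹ := by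
  rw [limitCosine_sq α₂ hα₁ hq ht]
  split_ifs with h
  · have e : α₁ + (α₂ / q₀ ^ 2 - α₁) * Real.exp (-2 * α₂ * t) = α₂ * invSqLimit α₁ α₂ q₀ t := by
      simp only [invSqLimit, relaxation, if_neg h]
      field_simp
      ring
    rw [e, mul_inv, mul_inv_cancel_left₀ h]
  · push Not at h
    simp [invSqLimit, relaxation, h, add_comm]

lemma SolvesOjaODE.continuousOn {α₁ α₂ q₀ : ℝ} {q : ℝ → ℝ} (h : SolvesOjaODE α₁ α₂ q₀ q) :
    ContinuousOn q (Set.Ici 0) := fun t ht => (h.2 t ht).continuousWithinAt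

/-- The drift has the one-sided Lipschitz constant `|α₂|`, since its cubic part is monotone. -/
lemma drift_oneSided_lipschitz {α₁ : ℝ} (hα₁ : 0 ≤ α₁) (α₂ q r : ℝ) :
    (q - r) * ((-α₁ * q ^ 3 + α₂ * q) - (-α₁ * r ^ 3 + α₂ * r)) ≤ |α₂| * (q - r) ^ 2 := by
  have h1 : 0 ≤ q ^ 2 + q * r + r ^ 2 := by nlinarith [sq_nonneg (q + r), sq_nonneg (q - r)]
  have h2 : α₂ * (q - r) ^ 2 ≤ |α₂| * (q - r) ^ 2 :=
    mul_le_mul_of_nonneg_right (le_abs_self _) (sq_nonneg _)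
  have h3 : 0 ≤ α₁ * ((q - r) ^ 2 * (q ^ 2 + q * r + r ^ 2)) := by positivity
  nlinarith

lemma SolvesOjaODE.unique {α₁ α₂ q₀ : ℝ} {q r : ℝ → ℝ} (hα₁ : 0 ≤ α₁)
    (hq : SolvesOjaODE α₁ α₂ q₀ q) (hr : SolvesOjaODE α₁ α₂ q₀ r) {t : ℝ} (ht : 0 ≤ t) :
    r t = q t := by
  -- `(r - q) ^ 2 * exp (-2 |α₂| t)` is nonincreasing and vanishes at `0`
  have hd : ∀ s, 0 ≤ s → HasDerivWithinAt
      (fun s => (r s - q s) ^ 2 * Real.exp (-2 * |α₂| * s))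
      ((2 * (r s - q s) * ((-α₁ * r s ^ 3 + α₂ * r s) - (-α₁ * q s ^ 3 + α₂ * q s)))
        * Real.exp (-2 * |α₂| * s) + (r s - q s) ^ 2 * (-2 * |α₂| * Real.exp (-2 * |α₂| * s)))
      (Set.Ici 0) s := by
    intro s hs
    have h1 := (((hr.2 s hs).sub (hq.2 s hs)).pow 2).mul
      (hasDerivAt_exp_neg_two_mul |α₂| s).hasDerivWithinAt
    refine h1.congr_deriv ?_
    simp
  have hanti : AntitoneOn (fun s => (r s - q s) ^ 2 * Real.exp (-2 * |α₂| * s)) (Set.Ici 0) := by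
    apply antitoneOn_of_hasDerivWithinAt_nonpos (convex_Ici 0)
      (fun s hs => (hd s hs).continuousWithinAt)
      (fun s hs => (hd s (interior_subset hs)).mono interior_subset)
    intro s _
    have := drift_oneSided_lipschitz hα₁ α₂ (r s) (q s)
    have he := Real.exp_pos (-2 * |α₂| * s)
    nlinarith
  have h := hanti Set.self_mem_Ici ht ht
  simp only [hr.1, hq.1, sub_self, ne_eq, OfNat.ofNat_ne_zero, not_false_eq_true, zero_pow,
    zero_mul] at h
  have h2 : (r t - q t) ^ 2 ≤ 0 := by
    by_contra hc
    push Not at hc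
    have := mul_pos hc (Real.exp_pos (-2 * |α₂| * t))
    linarith
  have h3 := pow_eq_zero_iff (two_ne_zero) |>.1 (le_antisymm h2 (sq_nonneg _))
  linarith

/-- A solution is bounded and Lipschitz on compact intervals, and the Euler scheme for it has a
local error of second order. -/
lemma SolvesOjaODE.exists_euler_error {α₁ α₂ q₀ : ℝ} {q : ℝ → ℝ} (h : SolvesOjaODE α₁ α₂ q₀ q)
    (T : ℝ) : ∃ C, 0 ≤ C ∧ (∀ s ∈ Set.Icc 0 T, ∀ t ∈ Set.Icc 0 T, |q t - q s| ≤ C * |t - s|) ∧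
      ∀ s t, 0 ≤ s → s ≤ t → t ≤ T →
        |q t - q s - (t - s) * (-α₁ * q s ^ 3 + α₂ * q s)| ≤ C * (t - s) ^ 2 := by
  have hcont : ContinuousOn q (Set.Icc 0 T) := h.continuousOn.mono Set.Icc_subset_Ici_self
  have hder : ∀ s ∈ Set.Icc 0 T, HasDerivWithinAt q (-α₁ * q s ^ 3 + α₂ * q s) (Set.Icc 0 T) s :=
    fun s hs => (h.2 s hs.1).mono Set.Icc_subset_Ici_self
  obtain ⟨M, hM⟩ := isCompact_Icc.exists_bound_of_continuousOn hcont
  obtain ⟨L, hL⟩ := isCompact_Icc.exists_bound_of_continuousOn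
    (f := fun s => -α₁ * q s ^ 3 + α₂ * q s) (s := Set.Icc 0 T) (by fun_prop)
  obtain ⟨L', hL'⟩ := isCompact_Icc.exists_bound_of_continuousOn
    (f := fun s => -α₁ * (3 * q s ^ 2 * (-α₁ * q s ^ 3 + α₂ * q s))
      + α₂ * (-α₁ * q s ^ 3 + α₂ * q s)) (s := Set.Icc 0 T) (by fun_prop)
  have hlip : ∀ s ∈ Set.Icc 0 T, ∀ t ∈ Set.Icc 0 T, |q t - q s| ≤ L * |t - s| := fun s hs t ht =>
    (convex_Icc 0 T).norm_image_sub_le_of_norm_hasDerivWithin_le hder hL hs ht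
  have hlip' : ∀ s ∈ Set.Icc 0 T, ∀ t ∈ Set.Icc 0 T,
      |(-α₁ * q t ^ 3 + α₂ * q t) - (-α₁ * q s ^ 3 + α₂ * q s)| ≤ L' * |t - s| := fun s hs t ht =>
    (convex_Icc 0 T).norm_image_sub_le_of_norm_hasDerivWithin_le
      (f := fun s => -α₁ * q s ^ 3 + α₂ * q s)
      (fun s hs => by
        have := (((hder s hs).pow 3).const_mul (-α₁)).add ((hder s hs).const_mul α₂)
        refine this.congr_deriv ?_
        simp) hL' hs ht
  refine ⟨max |L| |L'|, le_trans (abs_nonneg _) (le_max_left _ _), fun s hs t ht => ?_, ?_⟩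
  · refine (hlip s hs t ht).trans (mul_le_mul_of_nonneg_right ?_ (abs_nonneg _))
    exact (le_abs_self _).trans (le_max_left _ _)
  · intro s t hs hst htT
    have hsub : Set.Icc s t ⊆ Set.Icc 0 T := Set.Icc_subset_Icc hs htT
    have hC : L' ≤ max |L| |L'| := (le_abs_self _).trans (le_max_right _ _)
    have := (convex_Icc s t).norm_image_sub_le_of_norm_hasDerivWithin_le
      (f := fun x => q x - x * (-α₁ * q s ^ 3 + α₂ * q s)) (C := max |L| |L'| * (t - s))
      (f' := fun x => (-α₁ * q x ^ 3 + α₂ * q x) - (-α₁ * q s ^ 3 + α₂ * q s))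
      (fun x hx => by
        have := ((hder x (hsub hx)).mono hsub).sub
          (((hasDerivAt_id x).mul_const (-α₁ * q s ^ 3 + α₂ * q s)).hasDerivWithinAt)
        exact this.congr_deriv (by simp))
      (fun x hx => by
        rw [Real.norm_eq_abs]
        refine (hlip' s (hsub ⟨le_rfl, hst⟩) x (hsub hx)).trans ?_
        rw [abs_of_nonneg (by linarith [hx.1])]
        have := hx.1; have := hx.2
        have h0 : 0 ≤ max |L| |L'| := le_trans (abs_nonneg _) (le_max_left _ _)
        exact mul_le_mul hC (by linarith) (by linarith) h0)
      (Set.left_mem_Icc.2 hst) (Set.right_mem_Icc.2 hst)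
    rw [Real.norm_eq_abs, Real.norm_eq_abs, abs_of_nonneg (by linarith : 0 ≤ t - s)] at this
    calc _ = _ := by congr 1; ring
      _ ≤ _ := this
      _ = _ := by ring

end

noncomputable section

/-! ### Expansion of one step -/

lemma inv_sqrt_one_add_bounds {z : ℝ} (hz : 0 ≤ z) :
    0 < (Real.sqrt (1 + z))⁻¹ ∧ |(Real.sqrt (1 + z))⁻¹ - 1| ≤ z / 2 ∧
      (Real.sqrt (1 + z))⁻¹ ≤ 1 ∧ |(Real.sqrt (1 + z))⁻¹ - 1 + z / 2| ≤ z ^ 2 / 2 := by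
  set w := Real.sqrt (1 + z) with hw
  have hw1 : 1 ≤ w := Real.one_le_sqrt.2 (by linarith)
  have hw0 : 0 < w := by linarith
  have hz' : z = w ^ 2 - 1 := by rw [hw, Real.sq_sqrt (by linarith)]; ring
  have hi : 0 < w⁻¹ := inv_pos.2 hw0
  have hi1 : w⁻¹ ≤ 1 := inv_le_one_of_one_le₀ hw1
  -- `d = w - 1 ≥ 0` and `w⁻¹ = 1 - d w⁻¹`
  obtain ⟨d, hd⟩ : ∃ d, d = w - 1 := ⟨_, rfl⟩
  have hwd : w = 1 + d := by linarith
  have hd0 : 0 ≤ d := by linarith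
  have e1 : w⁻¹ - 1 + z / 2 = (w⁻¹ * d ^ 2) * (3 / 2 + d / 2) := by
    rw [hz', hwd]; field_simp; ring
  have e2 : w⁻¹ - 1 = -(w⁻¹ * d) := by rw [hwd]; field_simp; ring
  have hz2 : z = 2 * d + d ^ 2 := by rw [hz', hwd]; ring
  have hwd2 : w⁻¹ * d ^ 2 ≤ d ^ 2 := mul_le_of_le_one_left (sq_nonneg d) hi1
  have hwd1 : w⁻¹ * d ≤ d := mul_le_of_le_one_left hd0 hi1
  refine ⟨hi, ?_, hi1, ?_⟩
  · rw [e2, abs_neg, abs_of_nonneg (by positivity), hz2]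
    nlinarith
  · rw [e1, abs_of_nonneg (by positivity), hz2]
    have := mul_le_mul_of_nonneg_right hwd2 (by positivity : 0 ≤ 3 / 2 + d / 2)
    refine this.trans ?_
    nlinarith [pow_nonneg hd0 3, pow_nonneg hd0 4]

/-- The new cosine similarity after a step of Oja's method in dimension `P`, as a function of the
old one `q`, the scalar products `s`, `b` of the sample `y` with the directions of the iterate and
of the signal, and of `N = ‖y‖ ^ 2 / P`. -/
def nextCosine (τ P q s b N : ℝ) : ℝ :=
  (q + τ / P * (s * b)) * (Real.sqrt (1 + s ^ 2 / P * (2 * τ + τ ^ 2 * N)))⁻¹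

/-- Second order expansion of one step. The variable `K` controls the size of the noise. -/
lemma nextCosine_expansion {τ P q s b N K C : ℝ} (hτ : 0 ≤ τ) (hP : 1 ≤ P) (hq : |q| ≤ 1)
    (hK : 1 ≤ K) (hs : s ^ 2 ≤ C * K) (hsb : |s * b| ≤ C * K) (hN0 : 0 ≤ N) (hN : N ≤ C * K) :
    |nextCosine τ P q s b N - q - τ / P * (s * b)
        + q * (s ^ 2 / P * (2 * τ + τ ^ 2 * N)) / 2| ≤
      ((C * (2 * τ + τ ^ 2 * C)) ^ 2 / 2 + C * (2 * τ + τ ^ 2 * C) / 2 * (τ * C)) * K ^ 4 / P ^ 2 ∧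
    |nextCosine τ P q s b N - q| ≤ (C * (2 * τ + τ ^ 2 * C) / 2 + τ * C) * K ^ 2 / P := by
  have hP0 : 0 < P := by linarith
  have hCK : 0 ≤ C * K := (sq_nonneg s).trans hs
  have hC : 0 ≤ C := by
    by_contra h; push Not at h; nlinarith
  set z := s ^ 2 / P * (2 * τ + τ ^ 2 * N) with hzdef
  have hz0 : 0 ≤ z := by positivity
  set D := C * (2 * τ + τ ^ 2 * C) with hD
  have hD0 : 0 ≤ D := by positivity
  have hz : z ≤ D * K ^ 2 / P := by
    have h1 : 2 * τ + τ ^ 2 * N ≤ (2 * τ + τ ^ 2 * C) * K := by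
      have : τ ^ 2 * N ≤ τ ^ 2 * (C * K) := by gcongr
      nlinarith
    calc z = s ^ 2 * (2 * τ + τ ^ 2 * N) / P := by rw [hzdef]; ring
      _ ≤ (C * K) * ((2 * τ + τ ^ 2 * C) * K) / P := by gcongr
      _ = D * K ^ 2 / P := by rw [hD]; ring
  obtain ⟨ha0, ha1, ha2, ha3⟩ := inv_sqrt_one_add_bounds hz0
  unfold nextCosine
  rw [← hzdef]
  set A := (Real.sqrt (1 + z))⁻¹
  have ht : |τ / P * (s * b)| ≤ τ * C * K / P := by
    rw [abs_mul, abs_of_nonneg (by positivity : 0 ≤ τ / P)]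
    calc τ / P * |s * b| ≤ τ / P * (C * K) := by gcongr
      _ = _ := by ring
  have hKK : K ≤ K ^ 2 := by nlinarith
  have hKK' : K ^ 3 ≤ K ^ 4 := pow_le_pow_right₀ hK (by norm_num)
  have ha0' : |A| ≤ 1 := by rw [abs_of_pos ha0]; exact ha2
  constructor
  · have e : (q + τ / P * (s * b)) * A - q - τ / P * (s * b) + q * z / 2
        = q * (A - 1 + z / 2) + (A - 1) * (τ / P * (s * b)) := by ring
    rw [e]
    calc _ ≤ |q| * |A - 1 + z / 2| + |A - 1| * |τ / P * (s * b)| := by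
          rw [← abs_mul, ← abs_mul]; exact abs_add_le _ _
      _ ≤ 1 * (z ^ 2 / 2) + z / 2 * (τ * C * K / P) := by gcongr
      _ ≤ 1 * ((D * K ^ 2 / P) ^ 2 / 2) + (D * K ^ 2 / P) / 2 * (τ * C * K / P) := by gcongr
      _ = (D ^ 2 / 2 * K ^ 4 + D / 2 * (τ * C) * K ^ 3) / P ^ 2 := by field_simp
      _ ≤ (D ^ 2 / 2 * K ^ 4 + D / 2 * (τ * C) * K ^ 4) / P ^ 2 := by gcongr
      _ = _ := by ring
  · have e : (q + τ / P * (s * b)) * A - q = q * (A - 1) + A * (τ / P * (s * b)) := by ring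
    rw [e]
    calc _ ≤ |q| * |A - 1| + |A| * |τ / P * (s * b)| := by
          rw [← abs_mul, ← abs_mul]; exact abs_add_le _ _
      _ ≤ 1 * (z / 2) + 1 * (τ * C * K / P) := by gcongr
      _ ≤ 1 * ((D * K ^ 2 / P) / 2) + 1 * (τ * C * K ^ 2 / P) := by gcongr
      _ = _ := by ring

/-- Pointwise bounds for the scalar products `s = r c q + g`, `b = r c + h` of a sample and for its
normalized squared norm `N`, by a multiple of `K = 1 + c ^ 2 + g ^ 2 + h ^ 2 + A`. -/
lemma sample_bounds {ω c g h A P q r : ℝ} (hω : 0 ≤ ω) (hP : 1 ≤ P) (hq : |q| ≤ 1)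
    (hr : r ^ 2 ≤ 2 * ω) (hhA : h ^ 2 ≤ P * A) :
    (r * c * q + g) ^ 2 ≤ (4 * ω + 2) * (1 + c ^ 2 + g ^ 2 + h ^ 2 + A) ∧
    |(r * c * q + g) * (r * c + h)| ≤ (4 * ω + 2) * (1 + c ^ 2 + g ^ 2 + h ^ 2 + A) ∧
    0 ≤ (r ^ 2 * c ^ 2 + 2 * r * c * h) / P + A ∧
    (r ^ 2 * c ^ 2 + 2 * r * c * h) / P + A ≤ (4 * ω + 2) * (1 + c ^ 2 + g ^ 2 + h ^ 2 + A) ∧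
    |(r ^ 2 * c ^ 2 + 2 * r * c * h) / P + A - 1| ≤
      |A - 1| + (4 * ω + 2) * (1 + c ^ 2 + g ^ 2 + h ^ 2 + A) / P := by
  have hP0 : 0 < P := by linarith
  have hA : 0 ≤ A := nonneg_of_mul_nonneg_right ((sq_nonneg _).trans hhA) hP0
  have hq2 : q ^ 2 ≤ 1 := by rw [← sq_abs]; exact pow_le_one₀ (abs_nonneg _) hq
  obtain ⟨X, hX⟩ : ∃ X, X = r * c := ⟨_, rfl⟩
  have hX2 : X ^ 2 ≤ 2 * (ω * c ^ 2) := by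
    rw [hX, mul_pow, ← mul_assoc]; exact mul_le_mul_of_nonneg_right hr (sq_nonneg _)
  have e1 : r ^ 2 * c ^ 2 + 2 * r * c * h = X ^ 2 + 2 * X * h := by rw [hX]; ring
  rw [e1, ← hX]
  have hK : 4 * (ω * c ^ 2) + 2 * g ^ 2 + 2 * h ^ 2 + 2 * A
      ≤ (4 * ω + 2) * (1 + c ^ 2 + g ^ 2 + h ^ 2 + A) := by
    have e : (4 * ω + 2) * (1 + c ^ 2 + g ^ 2 + h ^ 2 + A)
        = (4 * (ω * c ^ 2) + 2 * g ^ 2 + 2 * h ^ 2 + 2 * A)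
          + (4 * ω * (1 + g ^ 2 + h ^ 2 + A) + 2 + 2 * c ^ 2) := by ring
    have : 0 ≤ 4 * ω * (1 + g ^ 2 + h ^ 2 + A) + 2 + 2 * c ^ 2 := by positivity
    linarith
  set B := (4 * ω + 2) * (1 + c ^ 2 + g ^ 2 + h ^ 2 + A)
  have hg := sq_nonneg g
  have hh := sq_nonneg h
  have hc := mul_nonneg hω (sq_nonneg c)
  have hs : (X * q + g) ^ 2 ≤ B := by
    have h1 : (X * q) ^ 2 ≤ X ^ 2 := by
      rw [mul_pow]; exact mul_le_of_le_one_right (sq_nonneg _) hq2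
    have h2 := add_sq_le (a := X * q) (b := g)
    linarith
  have hb : (X + h) ^ 2 ≤ B := by
    have h2 := add_sq_le (a := X) (b := h)
    linarith
  refine ⟨hs, ?_, ?_, ?_, ?_⟩
  · have h1 := two_mul_le_add_sq |X * q + g| |X + h|
    rw [sq_abs, sq_abs] at h1
    rw [abs_mul]
    linarith
  · have e : (X ^ 2 + 2 * X * h) / P + A = ((X + h) ^ 2 + (P * A - h ^ 2)) / P := by
      field_simp; ring
    rw [e]
    exact div_nonneg (by linarith [sq_nonneg (X + h)]) hP0.le
  · have h1 : (X ^ 2 + 2 * X * h) / P ≤ 2 * X ^ 2 + A := by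
      rw [div_le_iff₀ hP0]
      have h2 := two_mul_le_add_sq X h
      have h3 : 2 * X ^ 2 ≤ 2 * X ^ 2 * P := le_mul_of_one_le_right (by positivity) hP
      linarith
    linarith
  · have e : (X ^ 2 + 2 * X * h) / P + A - 1 = (A - 1) + (X ^ 2 + 2 * X * h) / P := by ring
    rw [e]
    refine (abs_add_le _ _).trans (add_le_add_right ?_ _)
    rw [abs_div, abs_of_pos hP0]
    gcongr
    have h2 := two_mul_le_add_sq X h
    rw [abs_le]
    constructor <;> linarith [sq_nonneg (X + h), sq_nonneg X]

/-- `nextCosine` for the sample whose signal coefficient is `c` and whose noise has components `g`,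
`h` along the directions of the iterate and of the signal and squared norm `P * A`; here
`r = √(ω / P) ‖ξ‖`, so that `r ^ 2 ≈ ω`. -/
def noisyCosine (τ P q r c g h A : ℝ) : ℝ :=
  nextCosine τ P q (r * c * q + g) (r * c + h) ((r ^ 2 * c ^ 2 + 2 * r * c * h) / P + A)

/-- The noise entering one step in dimension `P`: `c` is the coefficient of the signal, `g` and `h`
are the components of the isotropic noise `a` along the directions of the iterate and of the
signal, whose scalar product is `q`, and `A = ‖a‖ ^ 2 / P`. Only second moments are prescribed
exactly; `M` bounds the higher ones and the variance of `A`. -/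
structure StepNoise {Ω : Type*} [MeasurableSpace Ω] (μ : Measure Ω) (c g h A : Ω → ℝ)
    (P q M : ℝ) : Prop where
  measurable_c : Measurable c
  measurable_g : Measurable g
  measurable_h : Measurable h
  measurable_A : Measurable A
  one_le : 1 ≤ P
  abs_le_one : |q| ≤ 1
  sq_le : ∀ x, h x ^ 2 ≤ P * A x
  integrable_size : Integrable (fun x => (1 + c x ^ 2 + g x ^ 2 + h x ^ 2 + A x) ^ 4) μ
  size_le : ∫ x, (1 + c x ^ 2 + g x ^ 2 + h x ^ 2 + A x) ^ 4 ∂μ ≤ M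
  norm_fluctuation : ∫ x, (A x - 1) ^ 2 ∂μ ≤ M / P
  cc : ∫ x, c x ^ 2 ∂μ = 1
  gg : ∫ x, g x ^ 2 ∂μ = 1
  cg : ∫ x, c x * g x ∂μ = 0
  ch : ∫ x, c x * h x ∂μ = 0
  gh : ∫ x, g x * h x ∂μ = q

namespace StepNoise

variable {Ω : Type*} [MeasurableSpace Ω] {μ : Measure Ω} {c g h A : Ω → ℝ} {P q M : ℝ}

lemma nonneg (H : StepNoise μ c g h A P q M) (x : Ω) : 0 ≤ A x :=
  nonneg_of_mul_nonneg_right ((sq_nonneg _).trans (H.sq_le x)) (by linarith [H.one_le])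

lemma one_le_size (H : StepNoise μ c g h A P q M) (x : Ω) :
    1 ≤ 1 + c x ^ 2 + g x ^ 2 + h x ^ 2 + A x := by
  have := H.nonneg x
  linarith [sq_nonneg (c x), sq_nonneg (g x), sq_nonneg (h x)]

lemma integrable_of_le (H : StepNoise μ c g h A P q M) {f : Ω → ℝ} {B : ℝ} {n : ℕ} (hn : n ≤ 4)
    (hB : 0 ≤ B) (mf : Measurable f)
    (hf : ∀ x, |f x| ≤ B * (1 + c x ^ 2 + g x ^ 2 + h x ^ 2 + A x) ^ n) : Integrable f μ :=
  (H.integrable_size.const_mul B).mono' mf.aestronglyMeasurable (ae_of_all _ fun x =>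
    (hf x).trans (mul_le_mul_of_nonneg_left (pow_le_pow_right₀ (H.one_le_size x) hn) hB))

lemma integrable_size_sq (H : StepNoise μ c g h A P q M) :
    Integrable (fun x => (1 + c x ^ 2 + g x ^ 2 + h x ^ 2 + A x) ^ 2) μ := by
  have := H.measurable_c; have := H.measurable_g; have := H.measurable_h; have := H.measurable_A
  refine H.integrable_of_le (n := 2) (by norm_num) zero_le_one (by fun_prop) fun x => ?_
  rw [one_mul, abs_of_nonneg (sq_nonneg _)]

lemma integral_size_sq_le (H : StepNoise μ c g h A P q M) :
    ∫ x, (1 + c x ^ 2 + g x ^ 2 + h x ^ 2 + A x) ^ 2 ∂μ ≤ M :=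
  (integral_mono H.integrable_size_sq H.integrable_size fun x =>
    pow_le_pow_right₀ (H.one_le_size x) (by norm_num)).trans H.size_le

lemma integrable_mul_of_le (H : StepNoise μ c g h A P q M) {u v : Ω → ℝ} (mu : Measurable u)
    (mv : Measurable v) (hu : ∀ x, u x ^ 2 ≤ 1 + c x ^ 2 + g x ^ 2 + h x ^ 2 + A x)
    (hv : ∀ x, v x ^ 2 ≤ 1 + c x ^ 2 + g x ^ 2 + h x ^ 2 + A x) :
    Integrable (fun x => u x * v x) μ := by
  refine H.integrable_of_le (n := 1) (by norm_num) zero_le_one (by fun_prop) fun x => ?_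
  have h1 := two_mul_le_add_sq |u x| |v x|
  rw [sq_abs, sq_abs] at h1
  rw [abs_mul, one_mul, pow_one]
  linarith [hu x, hv x]

lemma integrable_products (H : StepNoise μ c g h A P q M) :
    Integrable (fun x => c x ^ 2) μ ∧ Integrable (fun x => g x ^ 2) μ ∧
    Integrable (fun x => c x * g x) μ ∧ Integrable (fun x => c x * h x) μ ∧
    Integrable (fun x => g x * h x) μ := by
  have mc := H.measurable_c
  have mg := H.measurable_g
  have mh := H.measurable_h
  have hc : ∀ x, c x ^ 2 ≤ 1 + c x ^ 2 + g x ^ 2 + h x ^ 2 + A x := fun x => by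
    linarith [H.nonneg x, sq_nonneg (c x), sq_nonneg (g x), sq_nonneg (h x)]
  have hg : ∀ x, g x ^ 2 ≤ 1 + c x ^ 2 + g x ^ 2 + h x ^ 2 + A x := fun x => by
    linarith [H.nonneg x, sq_nonneg (c x), sq_nonneg (g x), sq_nonneg (h x)]
  have hh : ∀ x, h x ^ 2 ≤ 1 + c x ^ 2 + g x ^ 2 + h x ^ 2 + A x := fun x => by
    linarith [H.nonneg x, sq_nonneg (c x), sq_nonneg (g x), sq_nonneg (h x)]
  refine ⟨?_, ?_, H.integrable_mul_of_le mc mg hc hg, H.integrable_mul_of_le mc mh hc hh,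
    H.integrable_mul_of_le mg mh hg hh⟩
  · simpa only [sq] using H.integrable_mul_of_le mc mc hc hc
  · simpa only [sq] using H.integrable_mul_of_le mg mg hg hg

lemma integral_s_mul_b (H : StepNoise μ c g h A P q M) (r : ℝ) :
    ∫ x, (r * c x * q + g x) * (r * c x + h x) ∂μ = r ^ 2 * q + q := by
  obtain ⟨ic2, ig2, icg, ich, igh⟩ := H.integrable_products
  calc ∫ x, (r * c x * q + g x) * (r * c x + h x) ∂μ
      = ∫ x, ((r ^ 2 * q * c x ^ 2 + r * q * (c x * h x))
          + (r * (c x * g x) + g x * h x)) ∂μ := by congr 1; funext x; ring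
    _ = (∫ x, r ^ 2 * q * c x ^ 2 ∂μ + ∫ x, r * q * (c x * h x) ∂μ)
          + (∫ x, r * (c x * g x) ∂μ + ∫ x, g x * h x ∂μ) := by
        rw [← integral_add (ic2.const_mul _) (ich.const_mul _),
          ← integral_add (icg.const_mul _) igh]
        exact integral_add ((ic2.const_mul _).add (ich.const_mul _)) ((icg.const_mul _).add igh)
    _ = _ := by
        simp only [integral_const_mul, H.cc, H.ch, H.cg, H.gh]
        ring

lemma integral_s_sq (H : StepNoise μ c g h A P q M) (r : ℝ) :
    ∫ x, (r * c x * q + g x) ^ 2 ∂μ = r ^ 2 * q ^ 2 + 1 := by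
  obtain ⟨ic2, ig2, icg, ich, igh⟩ := H.integrable_products
  calc ∫ x, (r * c x * q + g x) ^ 2 ∂μ
      = ∫ x, ((r ^ 2 * q ^ 2 * c x ^ 2 + 2 * r * q * (c x * g x)) + g x ^ 2) ∂μ := by
        congr 1; funext x; ring
    _ = (∫ x, r ^ 2 * q ^ 2 * c x ^ 2 ∂μ + ∫ x, 2 * r * q * (c x * g x) ∂μ)
          + ∫ x, g x ^ 2 ∂μ := by
        rw [← integral_add (ic2.const_mul _) (icg.const_mul _)]
        exact integral_add ((ic2.const_mul _).add (icg.const_mul _)) ig2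
    _ = _ := by
        simp only [integral_const_mul, H.cc, H.cg, H.gg]
        ring

lemma nonneg_M (H : StepNoise μ c g h A P q M) : 0 ≤ M :=
  (integral_nonneg fun x => by have := H.one_le_size x; positivity).trans H.size_le

/-- The fluctuation of `‖y‖ ^ 2 / P` around `1` has a negligible effect on the second order term,
since it is of order `1 / √P` in mean square. -/
lemma integral_norm_fluctuation_mul_le (H : StepNoise μ c g h A P q M) {ω r : ℝ} (hω : 0 ≤ ω)
    (hr : r ^ 2 ≤ 2 * ω) :
    Integrable (fun x => ((r ^ 2 * c x ^ 2 + 2 * r * c x * h x) / P + A x - 1)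
      * (r * c x * q + g x) ^ 2) μ ∧
    |∫ x, ((r ^ 2 * c x ^ 2 + 2 * r * c x * h x) / P + A x - 1) * (r * c x * q + g x) ^ 2 ∂μ|
      ≤ ((4 * ω + 2) * M + (4 * ω + 2) ^ 2 * M) * (Real.sqrt P)⁻¹ := by
  have mc := H.measurable_c
  have mg := H.measurable_g
  have mh := H.measurable_h
  have mA := H.measurable_A
  have hP := H.one_le
  have hM := H.nonneg_M
  have hP0 : 0 < P := by linarith
  have hsq : 0 < Real.sqrt P := Real.sqrt_pos.2 hP0
  have hsqP : Real.sqrt P ^ 2 = P := Real.sq_sqrt hP0.le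
  have hsq1 : 1 ≤ Real.sqrt P := Real.one_le_sqrt.2 hP
  obtain ⟨t, ht⟩ : ∃ t, t = (Real.sqrt P)⁻¹ := ⟨_, rfl⟩
  rw [← ht]
  have ht0 : 0 < t := ht ▸ inv_pos.2 hsq
  have hst : Real.sqrt P * t = 1 := ht ▸ mul_inv_cancel₀ hsq.ne'
  have htP : t ^ 2 = 1 / P := by rw [ht, inv_pow, hsqP, one_div]
  have ht1 : t ≤ 1 := ht ▸ inv_le_one_of_one_le₀ hsq1
  have hPt : 1 / P ≤ t := by rw [← htP, sq]; exact mul_le_of_le_one_left ht0.le ht1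
  obtain ⟨C₁, hC₁⟩ : ∃ C₁, C₁ = 4 * ω + 2 := ⟨_, rfl⟩
  rw [← hC₁]
  have hC₁0 : 0 ≤ C₁ := by rw [hC₁]; positivity
  have iK2 := H.integrable_size_sq
  have iKM := H.integral_size_sq_le
  have iA2 : Integrable (fun x => (A x - 1) ^ 2) μ := by
    refine H.integrable_of_le (n := 2) (by norm_num) zero_le_one (by fun_prop) fun x => ?_
    rw [abs_of_nonneg (sq_nonneg _), one_mul, ← sq_abs]
    refine pow_le_pow_left₀ (abs_nonneg _) ?_ 2
    have h4 := H.nonneg x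
    rw [abs_le]
    constructor <;> linarith [sq_nonneg (c x), sq_nonneg (g x), sq_nonneg (h x)]
  have key : ∀ x, |((r ^ 2 * c x ^ 2 + 2 * r * c x * h x) / P + A x - 1)
      * (r * c x * q + g x) ^ 2| ≤ C₁ / 2 * Real.sqrt P * (A x - 1) ^ 2
        + (C₁ / 2 * t + C₁ ^ 2 / P) * (1 + c x ^ 2 + g x ^ 2 + h x ^ 2 + A x) ^ 2 := fun x => by
    obtain ⟨h1, -, -, -, h2⟩ :=
      sample_bounds (c := c x) (g := g x) hω hP H.abs_le_one hr (H.sq_le x)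
    rw [← hC₁] at h1 h2
    have hK := H.one_le_size x
    rw [abs_mul, abs_of_nonneg (sq_nonneg (r * c x * q + g x))]
    set K := 1 + c x ^ 2 + g x ^ 2 + h x ^ 2 + A x
    calc _ ≤ (|A x - 1| + C₁ * K / P) * (C₁ * K) :=
          mul_le_mul h2 h1 (sq_nonneg _) (by positivity)
      _ = C₁ * (|A x - 1| * K) + C₁ ^ 2 / P * K ^ 2 := by ring
      _ ≤ C₁ * ((Real.sqrt P * (A x - 1) ^ 2 + t * K ^ 2) / 2) + C₁ ^ 2 / P * K ^ 2 := by
          gcongr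
          -- the weight `√P` balances the two squares, since `(A - 1) ^ 2` has mean `O(1 / P)`
          rw [← sq_abs (A x - 1)]
          have h0 := mul_nonneg hsq.le (sq_nonneg (|A x - 1| - t * K))
          have e2 : Real.sqrt P * (|A x - 1| - t * K) ^ 2 = Real.sqrt P * |A x - 1| ^ 2
              - 2 * (Real.sqrt P * t) * (|A x - 1| * K) + (Real.sqrt P * t) * (t * K ^ 2) := by
            ring
          rw [e2, hst] at h0
          linarith
      _ = _ := by ring
  have iB := (iA2.const_mul (C₁ / 2 * Real.sqrt P)).add
    (iK2.const_mul (C₁ / 2 * t + C₁ ^ 2 / P))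
  have iN := iB.mono' (f := fun x => ((r ^ 2 * c x ^ 2 + 2 * r * c x * h x) / P + A x - 1)
      * (r * c x * q + g x) ^ 2) (by fun_prop) (ae_of_all _ key)
  refine ⟨iN, ?_⟩
  calc _ ≤ ∫ x, (C₁ / 2 * Real.sqrt P * (A x - 1) ^ 2
          + (C₁ / 2 * t + C₁ ^ 2 / P) * (1 + c x ^ 2 + g x ^ 2 + h x ^ 2 + A x) ^ 2) ∂μ :=
        abs_integral_le_integral_abs.trans (integral_mono iN.abs iB key)
    _ = C₁ / 2 * Real.sqrt P * ∫ x, (A x - 1) ^ 2 ∂μ + (C₁ / 2 * t + C₁ ^ 2 / P)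
          * ∫ x, (1 + c x ^ 2 + g x ^ 2 + h x ^ 2 + A x) ^ 2 ∂μ := by
        rw [← integral_const_mul, ← integral_const_mul]
        exact integral_add (iA2.const_mul _) (iK2.const_mul _)
    _ ≤ C₁ / 2 * Real.sqrt P * (M / P) + (C₁ / 2 * t + C₁ ^ 2 / P) * M := by
        have := H.norm_fluctuation
        gcongr
    _ = C₁ / 2 * M * (Real.sqrt P * (1 / P)) + C₁ / 2 * M * t + C₁ ^ 2 * M * (1 / P) := by ring
    _ = C₁ * M * t + C₁ ^ 2 * M * (1 / P) := by
        rw [← htP, sq, ← mul_assoc (Real.sqrt P), hst]; ring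
    _ ≤ C₁ * M * t + C₁ ^ 2 * M * t := by gcongr
    _ = _ := by ring

lemma noisyCosine_sub_bounds (H : StepNoise μ c g h A P q M) {τ ω r : ℝ} (hτ : 0 ≤ τ)
    (hω : 0 ≤ ω) (hr : r ^ 2 ≤ 2 * ω) {D₂ D₃ : ℝ}
    (hD₂ : D₂ = ((4 * ω + 2) * (2 * τ + τ ^ 2 * (4 * ω + 2))) ^ 2 / 2
      + (4 * ω + 2) * (2 * τ + τ ^ 2 * (4 * ω + 2)) / 2 * (τ * (4 * ω + 2)))
    (hD₃ : D₃ = (4 * ω + 2) * (2 * τ + τ ^ 2 * (4 * ω + 2)) / 2 + τ * (4 * ω + 2)) (x : Ω) :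
    |noisyCosine τ P q r (c x) (g x) (h x) (A x) - q
        - τ / P * ((r * c x * q + g x) * (r * c x + h x))
        + q / (2 * P) * ((2 * τ + τ ^ 2) * (r * c x * q + g x) ^ 2 + τ ^ 2 *
          (((r ^ 2 * c x ^ 2 + 2 * r * c x * h x) / P + A x - 1) * (r * c x * q + g x) ^ 2))|
      ≤ D₂ / P ^ 2 * (1 + c x ^ 2 + g x ^ 2 + h x ^ 2 + A x) ^ 4 ∧
    |noisyCosine τ P q r (c x) (g x) (h x) (A x) - q|
      ≤ D₃ / P * (1 + c x ^ 2 + g x ^ 2 + h x ^ 2 + A x) ^ 2 := by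
  obtain ⟨h1, h2, h3, h4, -⟩ :=
    sample_bounds (c := c x) (g := g x) hω H.one_le H.abs_le_one hr (H.sq_le x)
  obtain ⟨h5, h6⟩ := nextCosine_expansion hτ H.one_le H.abs_le_one (H.one_le_size x) h1 h2 h3 h4
  rw [← hD₂] at h5
  rw [← hD₃] at h6
  refine ⟨(le_of_eq ?_).trans (h5.trans (le_of_eq (by ring))), h6.trans (le_of_eq (by ring))⟩
  unfold noisyCosine
  congr 1
  ring

lemma measurable_noisyCosine (H : StepNoise μ c g h A P q M) (τ r : ℝ) :
    Measurable (fun x => noisyCosine τ P q r (c x) (g x) (h x) (A x)) := by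
  have mc := H.measurable_c
  have mg := H.measurable_g
  have mh := H.measurable_h
  have mA := H.measurable_A
  unfold noisyCosine nextCosine
  fun_prop

lemma integrable_noisyCosine [IsProbabilityMeasure μ] (H : StepNoise μ c g h A P q M) {τ ω r : ℝ} (hτ : 0 ≤ τ)
    (hω : 0 ≤ ω) (hr : r ^ 2 ≤ 2 * ω) :
    Integrable (fun x => noisyCosine τ P q r (c x) (g x) (h x) (A x)) μ := by
  have hb := fun x => (H.noisyCosine_sub_bounds hτ hω hr rfl rfl x).2
  have hP : 0 < P := by linarith [H.one_le]
  have i := H.integrable_of_le (n := 2) (by norm_num) (by positivity)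
    ((H.measurable_noisyCosine τ r).sub_const q) hb
  exact (i.add (integrable_const q)).congr (ae_of_all _ fun x => by simp)

/-- The increment of the cosine similarity in one step is of order `1 / P` in mean square. -/
lemma integral_noisyCosine_sub_sq_le (H : StepNoise μ c g h A P q M) {τ ω r : ℝ} (hτ : 0 ≤ τ)
    (hω : 0 ≤ ω) (hr : r ^ 2 ≤ 2 * ω) {D₃ : ℝ}
    (hD₃ : D₃ = (4 * ω + 2) * (2 * τ + τ ^ 2 * (4 * ω + 2)) / 2 + τ * (4 * ω + 2)) :
    Integrable (fun x => (noisyCosine τ P q r (c x) (g x) (h x) (A x) - q) ^ 2) μ ∧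
    ∫ x, (noisyCosine τ P q r (c x) (g x) (h x) (A x) - q) ^ 2 ∂μ ≤ D₃ ^ 2 * M / P ^ 2 := by
  have hb := fun x => (H.noisyCosine_sub_bounds hτ hω hr rfl hD₃ x).2
  have hP : 0 < P := by linarith [H.one_le]
  have hb2 : ∀ x, (noisyCosine τ P q r (c x) (g x) (h x) (A x) - q) ^ 2
      ≤ (D₃ / P) ^ 2 * (1 + c x ^ 2 + g x ^ 2 + h x ^ 2 + A x) ^ 4 := fun x => by
    rw [← sq_abs]
    exact (pow_le_pow_left₀ (abs_nonneg _) (hb x) 2).trans (le_of_eq (by ring))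
  have i := H.integrable_of_le (n := 4) le_rfl (sq_nonneg (D₃ / P))
    (((H.measurable_noisyCosine τ r).sub_const q).pow_const 2)
    (fun x => by rw [abs_of_nonneg (sq_nonneg _)]; exact hb2 x)
  refine ⟨i, (integral_mono i (H.integrable_size.const_mul _) hb2).trans ?_⟩
  calc _ = (D₃ / P) ^ 2 * ∫ x, (1 + c x ^ 2 + g x ^ 2 + h x ^ 2 + A x) ^ 4 ∂μ :=
        integral_const_mul _ _
    _ ≤ (D₃ / P) ^ 2 * M := by have := H.size_le; gcongr
    _ = _ := by ring

/-- The mean increment of the cosine similarity in one step is the drift of the limiting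
differential equation, up to errors from the length of the signal and from the noise. -/
lemma abs_integral_noisyCosine_sub_le [IsProbabilityMeasure μ] (H : StepNoise μ c g h A P q M)
    {τ ω r δ : ℝ} (hτ : 0 < τ) (hω : 0 < ω) (hr : |r ^ 2 - ω| ≤ ω * δ) (hδ : δ ≤ 1) {D₂ : ℝ}
    (hD₂ : D₂ = ((4 * ω + 2) * (2 * τ + τ ^ 2 * (4 * ω + 2))) ^ 2 / 2
      + (4 * ω + 2) * (2 * τ + τ ^ 2 * (4 * ω + 2)) / 2 * (τ * (4 * ω + 2))) :
    |∫ x, noisyCosine τ P q r (c x) (g x) (h x) (A x) ∂μ - q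
        - (-(τ * ω * (1 + τ / 2)) * q ^ 3 + τ * (ω - τ / 2) * q) / P|
      ≤ (2 * τ * ω + τ ^ 2 / 2 * ω) * δ / P
        + (τ ^ 2 / 2 * ((4 * ω + 2) * M + (4 * ω + 2) ^ 2 * M) + D₂ * M) * (Real.sqrt P)⁻¹ / P := by
  have hr2 : r ^ 2 ≤ 2 * ω := by
    have h1 := (le_abs_self _).trans hr
    have h2 : ω * δ ≤ ω := mul_le_of_le_one_right hω.le hδ
    linarith
  have hP := H.one_le
  have hP0 : 0 < P := by linarith
  have hM := H.nonneg_M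
  have mc := H.measurable_c
  have mg := H.measurable_g
  have mh := H.measurable_h
  have hD₂0 : 0 ≤ D₂ := by rw [hD₂]; positivity
  obtain ⟨t, ht⟩ : ∃ t, t = (Real.sqrt P)⁻¹ := ⟨_, rfl⟩
  have hPt : 1 / P ≤ t := by
    have hs := Real.one_le_sqrt.2 hP
    rw [ht, ← one_div]
    apply one_div_le_one_div_of_le (by linarith)
    calc Real.sqrt P ≤ Real.sqrt P * Real.sqrt P := le_mul_of_one_le_left (by linarith) hs
      _ = P := Real.mul_self_sqrt hP0.le
  obtain ⟨iN, hN⟩ := H.integral_norm_fluctuation_mul_le hω.le hr2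
  have hb := fun x => (H.noisyCosine_sub_bounds hτ.le hω.le hr2 hD₂ rfl x).1
  have iF := H.integrable_noisyCosine hτ.le hω.le hr2
  have Isb := H.integral_s_mul_b r
  have Iss := H.integral_s_sq r
  have bd := fun x => sample_bounds (c := c x) (g := g x) hω.le hP H.abs_le_one hr2 (H.sq_le x)
  have isb : Integrable (fun x => (r * c x * q + g x) * (r * c x + h x)) μ :=
    H.integrable_of_le (n := 1) (B := 4 * ω + 2) (by norm_num) (by positivity) (by fun_prop)
      fun x => by rw [pow_one]; exact (bd x).2.1
  have iss : Integrable (fun x => (r * c x * q + g x) ^ 2) μ :=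
    H.integrable_of_le (n := 1) (B := 4 * ω + 2) (by norm_num) (by positivity) (by fun_prop)
      fun x => by rw [pow_one, abs_of_nonneg (sq_nonneg _)]; exact (bd x).1
  rw [← ht] at hN ⊢
  clear bd mc mg mh
  -- from here on only the integrals of the following four functions matter
  generalize hFdef : (fun x => noisyCosine τ P q r (c x) (g x) (h x) (A x)) = F at *
  generalize hUdef : (fun x => (r * c x * q + g x) * (r * c x + h x)) = U at *
  generalize hSdef : (fun x => (r * c x * q + g x) ^ 2) = S at *
  generalize hJdef : (fun x => ((r ^ 2 * c x ^ 2 + 2 * r * c x * h x) / P + A x - 1)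
      * (r * c x * q + g x) ^ 2) = J at *
  have hb' : ∀ x, |F x - q - τ / P * U x + q / (2 * P) * ((2 * τ + τ ^ 2) * S x + τ ^ 2 * J x)|
      ≤ D₂ / P ^ 2 * (1 + c x ^ 2 + g x ^ 2 + h x ^ 2 + A x) ^ 4 := fun x => by
    rw [← hFdef, ← hUdef, ← hSdef, ← hJdef]; exact hb x
  have i1 : Integrable (fun x => F x - q - τ / P * U x) μ :=
    (iF.sub (integrable_const q)).sub (isb.const_mul _)
  have i2 : Integrable (fun x => (2 * τ + τ ^ 2) * S x + τ ^ 2 * J x) μ :=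
    (iss.const_mul _).add (iN.const_mul _)
  have IR : ∫ x, (F x - q - τ / P * U x
      + q / (2 * P) * ((2 * τ + τ ^ 2) * S x + τ ^ 2 * J x)) ∂μ
      = ∫ x, F x ∂μ - q - τ / P * (r ^ 2 * q + q)
        + q / (2 * P) * ((2 * τ + τ ^ 2) * (r ^ 2 * q ^ 2 + 1) + τ ^ 2 * ∫ x, J x ∂μ) := by
    rw [integral_add i1 (i2.const_mul _), integral_sub (f := fun x => F x - q)
      (iF.sub (integrable_const q)) (isb.const_mul _), integral_sub iF (integrable_const q),
      integral_const_mul, integral_const_mul,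
      integral_add (iss.const_mul _) (iN.const_mul _), integral_const_mul, integral_const_mul,
      Isb, Iss]
    simp
  have hR : |∫ x, F x ∂μ - q - τ / P * (r ^ 2 * q + q)
        + q / (2 * P) * ((2 * τ + τ ^ 2) * (r ^ 2 * q ^ 2 + 1) + τ ^ 2 * ∫ x, J x ∂μ)|
      ≤ D₂ * M * (t / P) := by
    rw [← IR]
    calc _ ≤ ∫ x, D₂ / P ^ 2 * (1 + c x ^ 2 + g x ^ 2 + h x ^ 2 + A x) ^ 4 ∂μ :=
          abs_integral_le_integral_abs.trans (integral_mono (i1.add (i2.const_mul _)).abs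
            (H.integrable_size.const_mul _) hb')
      _ = D₂ / P ^ 2 * ∫ x, (1 + c x ^ 2 + g x ^ 2 + h x ^ 2 + A x) ^ 4 ∂μ :=
          integral_const_mul _ _
      _ ≤ D₂ / P ^ 2 * M := by have := H.size_le; gcongr
      _ = D₂ * M * (1 / P * (1 / P)) := by ring
      _ ≤ D₂ * M * (t * (1 / P)) := by gcongr
      _ = _ := by ring
  have hq := H.abs_le_one
  have hq3 : |q ^ 3| ≤ 1 := by rw [abs_pow]; exact pow_le_one₀ (abs_nonneg _) hq
  generalize ∫ x, J x ∂μ = j at *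
  generalize ∫ x, F x ∂μ = f at *
  have b1 : |(τ * q - (τ + τ ^ 2 / 2) * q ^ 3) * (r ^ 2 - ω) / P|
      ≤ (2 * τ * ω + τ ^ 2 / 2 * ω) * δ / P := by
    rw [abs_div, abs_of_pos hP0, abs_mul]
    have : |τ * q - (τ + τ ^ 2 / 2) * q ^ 3| ≤ τ * 1 + (τ + τ ^ 2 / 2) * 1 := by
      refine (abs_sub _ _).trans ?_
      rw [abs_mul, abs_mul, abs_of_pos hτ, abs_of_pos (by positivity : 0 < τ + τ ^ 2 / 2)]
      gcongr
    calc _ ≤ (τ * 1 + (τ + τ ^ 2 / 2) * 1) * (ω * δ) / P := by gcongr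
      _ = _ := by ring
  have b2 : |q * (τ ^ 2 / 2 * j) / P|
      ≤ τ ^ 2 / 2 * ((4 * ω + 2) * M + (4 * ω + 2) ^ 2 * M) * t / P := by
    rw [abs_div, abs_of_pos hP0, abs_mul, abs_mul, abs_of_pos (by positivity : 0 < τ ^ 2 / 2)]
    calc _ ≤ 1 * (τ ^ 2 / 2 * (((4 * ω + 2) * M + (4 * ω + 2) ^ 2 * M) * t)) / P := by gcongr
      _ = _ := by ring
  have e : f - q - (-(τ * ω * (1 + τ / 2)) * q ^ 3 + τ * (ω - τ / 2) * q) / P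
      = (τ * q - (τ + τ ^ 2 / 2) * q ^ 3) * (r ^ 2 - ω) / P - q * (τ ^ 2 / 2 * j) / P
        + (f - q - τ / P * (r ^ 2 * q + q)
        + q / (2 * P) * ((2 * τ + τ ^ 2) * (r ^ 2 * q ^ 2 + 1) + τ ^ 2 * j)) := by
    field_simp; ring
  rw [e]
  calc _ ≤ (2 * τ * ω + τ ^ 2 / 2 * ω) * δ / P
        + τ ^ 2 / 2 * ((4 * ω + 2) * M + (4 * ω + 2) ^ 2 * M) * t / P + D₂ * M * (t / P) :=
      (abs_add_le _ _).trans (add_le_add ((abs_sub _ _).trans (add_le_add b1 b2)) hR)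
    _ = _ := by ring

end StepNoise

/-- The real inequality behind the Lyapunov step: `f` and `V` are the mean of the new cosine
similarity and the mean square of its increment, `e = 1 / P` and `t = 1 / √P`. -/
lemma lyapunov_inequality {α₁ α₂ q Q Q' f V E₁ E₂ L W δ t e : ℝ} (hα₁ : 0 ≤ α₁) (he0 : 0 ≤ e)
    (he1 : e ≤ 1) (ht2 : t ^ 2 = e) (hW : 0 ≤ W)
    (hF1 : |f - q - (-α₁ * q ^ 3 + α₂ * q) * e| ≤ E₁ * δ * e + E₂ * t * e)
    (hF2 : V ≤ W * e ^ 2) (hQ1 : |Q' - Q| ≤ L * e)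
    (hQ2 : |Q' - Q - (-α₁ * Q ^ 3 + α₂ * Q) * e| ≤ L * e ^ 2) :
    2 * (q - Q) * (f - q) + 2 * V + ((q - Q) ^ 2 - 2 * (q - Q) * (Q' - Q) + 2 * (Q' - Q) ^ 2)
      ≤ (1 + (2 * |α₂| + 1 + 3 * (E₁ ^ 2 + E₂ ^ 2 + L ^ 2) + 2 * W + 2 * L ^ 2) * e) * (q - Q) ^ 2
        + (2 * |α₂| + 1 + 3 * (E₁ ^ 2 + E₂ ^ 2 + L ^ 2) + 2 * W + 2 * L ^ 2) * (δ ^ 2 + e) * e := by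
  have hdrift := drift_oneSided_lipschitz hα₁ α₂ q Q
  -- the mean increment minus the increment of `Q`
  have hm : 2 * (q - Q) * (f - q - (Q' - Q)) ≤
      2 * |α₂| * (q - Q) ^ 2 * e + ((q - Q) ^ 2 + (E₁ * δ + E₂ * t + L * e) ^ 2) * e := by
    have e1 : f - q - (Q' - Q) = (f - q - (-α₁ * q ^ 3 + α₂ * q) * e)
        - (Q' - Q - (-α₁ * Q ^ 3 + α₂ * Q) * e)
        + ((-α₁ * q ^ 3 + α₂ * q) - (-α₁ * Q ^ 3 + α₂ * Q)) * e := by ring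
    have e2 : |(f - q - (-α₁ * q ^ 3 + α₂ * q) * e) - (Q' - Q - (-α₁ * Q ^ 3 + α₂ * Q) * e)|
        ≤ (E₁ * δ + E₂ * t + L * e) * e :=
      (abs_sub _ _).trans ((add_le_add hF1 hQ2).trans (le_of_eq (by ring)))
    have e3 := mul_le_mul_of_nonneg_right hdrift he0
    have e4 : (q - Q) * ((f - q - (-α₁ * q ^ 3 + α₂ * q) * e)
        - (Q' - Q - (-α₁ * Q ^ 3 + α₂ * Q) * e)) ≤ |q - Q| * ((E₁ * δ + E₂ * t + L * e) * e) := by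
      refine (le_abs_self _).trans ?_
      rw [abs_mul]
      exact mul_le_mul_of_nonneg_left e2 (abs_nonneg _)
    have e5 := mul_le_mul_of_nonneg_right
      (two_mul_le_add_sq |q - Q| (E₁ * δ + E₂ * t + L * e)) he0
    rw [sq_abs] at e5
    rw [e1]
    linarith
  have hsum : (E₁ * δ + E₂ * t + L * e) ^ 2 ≤ 3 * (E₁ ^ 2 + E₂ ^ 2 + L ^ 2) * (δ ^ 2 + e) := by
    have h1 : (E₁ * δ + E₂ * t + L * e) ^ 2
        ≤ 3 * (E₁ ^ 2 * δ ^ 2 + E₂ ^ 2 * t ^ 2 + L ^ 2 * e ^ 2) := by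
      have e1 : 3 * (E₁ ^ 2 * δ ^ 2 + E₂ ^ 2 * t ^ 2 + L ^ 2 * e ^ 2)
          - (E₁ * δ + E₂ * t + L * e) ^ 2 = (E₁ * δ - E₂ * t) ^ 2 + (E₁ * δ - L * e) ^ 2
            + (E₂ * t - L * e) ^ 2 := by ring
      have : 0 ≤ (E₁ * δ - E₂ * t) ^ 2 + (E₁ * δ - L * e) ^ 2 + (E₂ * t - L * e) ^ 2 := by
        positivity
      linarith
    have h2 : e ^ 2 ≤ e := by rw [sq]; exact mul_le_of_le_one_left he0 he1
    have h3 : L ^ 2 * e ^ 2 ≤ L ^ 2 * e := mul_le_mul_of_nonneg_left h2 (sq_nonneg _)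
    rw [ht2] at h1
    have h4 : 0 ≤ E₁ ^ 2 * e + E₂ ^ 2 * δ ^ 2 + L ^ 2 * δ ^ 2 := by positivity
    linarith
  have hsum' := mul_le_mul_of_nonneg_right hsum he0
  have hΓ : (Q' - Q) ^ 2 ≤ L ^ 2 * e ^ 2 := by
    rw [← sq_abs, ← mul_pow]
    exact pow_le_pow_left₀ (abs_nonneg _) hQ1 2
  have hd := sq_nonneg (q - Q)
  have p1 : 0 ≤ (3 * (E₁ ^ 2 + E₂ ^ 2 + L ^ 2) + 2 * W + 2 * L ^ 2)
      * (q - Q) ^ 2 * e := by positivity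
  have p2 : 0 ≤ (2 * |α₂| + 1) * (δ ^ 2 + e) * e := by positivity
  have p3 : 0 ≤ (2 * W + 2 * L ^ 2) * δ ^ 2 * e := by positivity
  linarith


/-- One step of the Lyapunov estimate: the mean squared distance between the cosine similarity and
the solution of the differential equation, whose values before and after the step are `Q` and
`Q'`. -/
theorem exists_lyapunov_step (τ ω M L : ℝ) (hτ : 0 < τ) (hω : 0 < ω) (hM : 0 ≤ M) :
    ∃ B, 0 ≤ B ∧ ∀ {Ω : Type} [MeasurableSpace Ω] (μ : Measure Ω) [IsProbabilityMeasure μ]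
      (c g h A : Ω → ℝ) (P q r δ Q Q' : ℝ), StepNoise μ c g h A P q M →
      |r ^ 2 - ω| ≤ ω * δ → δ ≤ 1 → |Q' - Q| ≤ L / P →
      |Q' - Q - (-(τ * ω * (1 + τ / 2)) * Q ^ 3 + τ * (ω - τ / 2) * Q) / P| ≤ L / P ^ 2 →
      Integrable (fun x => (noisyCosine τ P q r (c x) (g x) (h x) (A x) - Q') ^ 2) μ ∧
      ∫ x, (noisyCosine τ P q r (c x) (g x) (h x) (A x) - Q') ^ 2 ∂μ
        ≤ (1 + B / P) * (q - Q) ^ 2 + B * (δ ^ 2 + 1 / P) / P := by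
  obtain ⟨D₂, hD₂⟩ : ∃ D, D = ((4 * ω + 2) * (2 * τ + τ ^ 2 * (4 * ω + 2))) ^ 2 / 2
      + (4 * ω + 2) * (2 * τ + τ ^ 2 * (4 * ω + 2)) / 2 * (τ * (4 * ω + 2)) := ⟨_, rfl⟩
  obtain ⟨D₃, hD₃⟩ : ∃ D, D = (4 * ω + 2) * (2 * τ + τ ^ 2 * (4 * ω + 2)) / 2
    + τ * (4 * ω + 2) := ⟨_, rfl⟩
  have hD₂0 : 0 ≤ D₂ := by rw [hD₂]; positivity
  obtain ⟨E₁, hE₁⟩ : ∃ E, E = 2 * τ * ω + τ ^ 2 / 2 * ω := ⟨_, rfl⟩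
  obtain ⟨E₂, hE₂⟩ : ∃ E, E = τ ^ 2 / 2 * ((4 * ω + 2) * M + (4 * ω + 2) ^ 2 * M) + D₂ * M :=
    ⟨_, rfl⟩
  have hE₁0 : 0 ≤ E₁ := by rw [hE₁]; positivity
  have hE₂0 : 0 ≤ E₂ := by rw [hE₂]; positivity
  refine ⟨2 * |τ * (ω - τ / 2)| + 1 + 3 * (E₁ ^ 2 + E₂ ^ 2 + L ^ 2)
    + 2 * (D₃ ^ 2 * M) + 2 * L ^ 2, by positivity, ?_⟩
  intro Ω _ μ _ c g h A P q r δ Q Q' H hr hδ hQ1 hQ2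
  have hr2 : r ^ 2 ≤ 2 * ω := by
    have h1 := (le_abs_self _).trans hr
    have h2 : ω * δ ≤ ω := mul_le_of_le_one_right hω.le hδ
    linarith
  have hP := H.one_le
  have hP0 : 0 < P := by linarith
  have iF := H.integrable_noisyCosine hτ.le hω.le hr2
  obtain ⟨iF2, hF2⟩ := H.integral_noisyCosine_sub_sq_le hτ.le hω.le hr2 hD₃
  have hF1 := H.abs_integral_noisyCosine_sub_le hτ hω hr hδ hD₂
  rw [← hE₁, ← hE₂] at hF1
  obtain ⟨F, hF⟩ : ∃ F : Ω → ℝ, ∀ x, noisyCosine τ P q r (c x) (g x) (h x) (A x) = F x :=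
    ⟨_, fun _ => rfl⟩
  simp only [hF] at iF iF2 hF2 hF1 ⊢
  have mF : Measurable F := by
    have := H.measurable_noisyCosine τ r
    simpa only [hF] using this
  -- only the term linear in the increment `F - q` needs its mean, the others are quadratic
  have hle : ∀ x, (F x - Q') ^ 2 ≤ 2 * (q - Q) * (F x - q)
      + 2 * (F x - q) ^ 2 + ((q - Q) ^ 2 - 2 * (q - Q) * (Q' - Q) + 2 * (Q' - Q) ^ 2) := fun x => by
    linarith [sq_nonneg (F x - q + (Q' - Q))]
  have i1 : Integrable (fun x => 2 * (q - Q) * (F x - q)) μ :=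
    (iF.sub (integrable_const q)).const_mul _
  have i2 : Integrable (fun x => 2 * (q - Q) * (F x - q) + 2 * (F x - q) ^ 2) μ :=
    i1.add (iF2.const_mul _)
  have i3 := i2.add (integrable_const ((q - Q) ^ 2 - 2 * (q - Q) * (Q' - Q) + 2 * (Q' - Q) ^ 2))
  have i4 : Integrable (fun x => (F x - Q') ^ 2) μ :=
    i3.mono' (by fun_prop) (ae_of_all _ fun x => by
      rw [Real.norm_eq_abs, abs_of_nonneg (sq_nonneg _)]; exact hle x)
  refine ⟨i4, (integral_mono i4 i3 hle).trans ?_⟩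
  have I : ∫ x, (2 * (q - Q) * (F x - q) + 2 * (F x - q) ^ 2
      + ((q - Q) ^ 2 - 2 * (q - Q) * (Q' - Q) + 2 * (Q' - Q) ^ 2)) ∂μ
      = 2 * (q - Q) * (∫ x, F x ∂μ - q) + 2 * ∫ x, (F x - q) ^ 2 ∂μ
        + ((q - Q) ^ 2 - 2 * (q - Q) * (Q' - Q) + 2 * (Q' - Q) ^ 2) := by
    rw [integral_add i2 (integrable_const _), integral_add i1 (iF2.const_mul _),
      integral_const_mul, integral_const_mul, integral_sub iF (integrable_const q)]
    simp
  refine (le_of_eq I).trans ?_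
  generalize ∫ x, F x ∂μ = f at *
  generalize ∫ x, (F x - q) ^ 2 ∂μ = V at *
  obtain ⟨e, he⟩ : ∃ e, e = P⁻¹ := ⟨_, rfl⟩
  have he0 : 0 ≤ e := by rw [he]; positivity
  have he1 : e ≤ 1 := by rw [he]; exact inv_le_one_of_one_le₀ hP
  have ht2 : (Real.sqrt P)⁻¹ ^ 2 = e := by rw [inv_pow, Real.sq_sqrt hP0.le, he]
  simp only [div_eq_mul_inv _ P, div_eq_mul_inv _ (P ^ 2), one_mul, ← inv_pow P, ← he]
    at hF1 hF2 hQ1 hQ2 ⊢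
  exact lyapunov_inequality (by positivity) he0 he1 ht2 (by positivity) hF1 hF2 hQ1 hQ2

end

noncomputable section

/-! ### Moments of the Gaussian noise -/

lemma integrable_pow_gaussianReal (n : ℕ) : Integrable (fun x : ℝ => x ^ n) (gaussianReal 0 1) := by
  rcases Nat.eq_zero_or_pos n with rfl | hn
  · simp
  · have h := (memLp_id_gaussianReal' (μ := 0) (v := 1) (n : ENNReal) (by simp)).integrable_norm_pow
      hn.ne'
    refine h.mono' (by fun_prop) (ae_of_all _ fun x => ?_)
    simp

lemma integral_sq_gaussianReal : ∫ x : ℝ, x ^ 2 ∂(gaussianReal 0 1) = 1 := by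
  have h := variance_of_integral_eq_zero (μ := gaussianReal 0 1) (X := id) (by fun_prop)
    (by simp)
  rw [variance_id_gaussianReal] at h
  simpa using h.symm

section stdGaussian

variable {E : Type*} [NormedAddCommGroup E] [InnerProductSpace ℝ E] [FiniteDimensional ℝ E]
  [MeasurableSpace E] [BorelSpace E]

/-- The one-dimensional marginals of a standard Gaussian vector are standard Gaussian. -/
lemma measurePreserving_inner_stdGaussian {v : E} (hv : ‖v‖ = 1) :
    MeasurePreserving (fun a => inner ℝ v a) (stdGaussian E) (gaussianReal 0 1) := by
  refine ⟨by fun_prop, ?_⟩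
  have h := IsGaussian.map_eq_gaussianReal (μ := stdGaussian E) (innerSL ℝ v)
  rw [variance_dual_stdGaussian, integral_strongDual_stdGaussian, innerSL_apply_norm, hv] at h
  simpa using h

lemma integrable_inner_pow_stdGaussian {v : E} (hv : ‖v‖ = 1) (n : ℕ) :
    Integrable (fun a => inner ℝ v a ^ n) (stdGaussian E) :=
  (measurePreserving_inner_stdGaussian hv).integrable_comp_of_integrable
    (integrable_pow_gaussianReal n)

lemma integral_inner_pow_stdGaussian {v : E} (hv : ‖v‖ = 1) (n : ℕ) :
    ∫ a, inner ℝ v a ^ n ∂(stdGaussian E) = ∫ x, x ^ n ∂(gaussianReal 0 1) := by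
  rw [← (measurePreserving_inner_stdGaussian hv).map_eq,
    integral_map (by fun_prop) (by fun_prop)]

lemma integral_inner_stdGaussian (v : E) : ∫ a, inner ℝ v a ∂(stdGaussian E) = 0 := by
  simpa using integral_strongDual_stdGaussian (innerSL ℝ v)

lemma integral_inner_mul_inner_stdGaussian (v e : E) :
    ∫ a, inner ℝ v a * inner ℝ e a ∂(stdGaussian E) = inner ℝ v e := by
  have h := covarianceBilin_apply (μ := stdGaussian E) (IsGaussian.memLp_two_id) v e
  rw [covarianceBilin_stdGaussian, innerSL_apply_apply] at h
  simpa using h.symm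

end stdGaussian

variable {p : ℕ}

lemma norm_sq_div_eq_sum (a : EuclideanSpace ℝ (Fin p)) :
    ‖a‖ ^ 2 / p = ∑ i, (1 / (p : ℝ)) * a i ^ 2 := by
  rw [EuclideanSpace.norm_sq_eq, ← Finset.mul_sum]
  simp only [Real.norm_eq_abs, sq_abs]
  ring

lemma integrable_coord_pow_stdGaussian (i : Fin p) (n : ℕ) :
    Integrable (fun a : EuclideanSpace ℝ (Fin p) => a i ^ n) (stdGaussian _) := by
  have h := integrable_inner_pow_stdGaussian (v := EuclideanSpace.single i (1 : ℝ)) (by simp) n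
  simpa [EuclideanSpace.inner_single_left] using h

lemma integral_coord_pow_stdGaussian (i : Fin p) (n : ℕ) :
    ∫ a : EuclideanSpace ℝ (Fin p), a i ^ n ∂(stdGaussian _) = ∫ x, x ^ n ∂(gaussianReal 0 1) := by
  have h := integral_inner_pow_stdGaussian (v := EuclideanSpace.single i (1 : ℝ)) (by simp) n
  simpa [EuclideanSpace.inner_single_left] using h

/-- Convexity of `x ^ 4` bounds the moments of `‖a‖ ^ 2 / p` independently of the dimension. -/
lemma norm_sq_div_pow_four_le (hp : 1 ≤ p) (a : EuclideanSpace ℝ (Fin p)) :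
    (‖a‖ ^ 2 / p) ^ 4 ≤ ∑ i, (1 / (p : ℝ)) * a i ^ 8 := by
  have hp0 : (p : ℝ) ≠ 0 := by positivity
  rw [norm_sq_div_eq_sum]
  refine (Real.pow_arith_mean_le_arith_mean_pow Finset.univ (fun _ => 1 / (p : ℝ))
    (fun i => a i ^ 2) (fun _ _ => by positivity) (by simp [hp0]) (fun _ _ => sq_nonneg _)
    4).trans (le_of_eq ?_)
  refine Finset.sum_congr rfl fun i _ => ?_
  ring

lemma integrable_sum_coord_pow :
    Integrable (fun a : EuclideanSpace ℝ (Fin p) => ∑ i, (1 / (p : ℝ)) * a i ^ 8)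
      (stdGaussian _) :=
  integrable_finsetSum _ fun i _ => (integrable_coord_pow_stdGaussian i 8).const_mul _

lemma integral_sum_coord_pow (hp : 1 ≤ p) :
    ∫ a : EuclideanSpace ℝ (Fin p), ∑ i, (1 / (p : ℝ)) * a i ^ 8 ∂(stdGaussian _)
      = ∫ x, x ^ 8 ∂(gaussianReal 0 1) := by
  have hp0 : (p : ℝ) ≠ 0 := by positivity
  rw [integral_finsetSum _ fun i _ => (integrable_coord_pow_stdGaussian i 8).const_mul _]
  simp only [integral_const_mul, integral_coord_pow_stdGaussian, Finset.sum_const,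
    Finset.card_univ, Fintype.card_fin, nsmul_eq_mul]
  field_simp

/-- The variance of `‖a‖ ^ 2 / p`, by independence of the coordinates. -/
lemma integral_norm_sq_div_sub_one_sq (hp : 1 ≤ p) :
    ∫ a : EuclideanSpace ℝ (Fin p), (‖a‖ ^ 2 / p - 1) ^ 2 ∂(stdGaussian _)
      = (∫ x : ℝ, (x ^ 2 - 1) ^ 2 ∂(gaussianReal 0 1)) / (p : ℝ) := by
  have hp0 : (p : ℝ) ≠ 0 := by positivity
  have i2 : Integrable (fun x : ℝ => x ^ 2 - 1) (gaussianReal 0 1) :=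
    (integrable_pow_gaussianReal 2).sub (integrable_const 1)
  have I2 : ∫ x : ℝ, (x ^ 2 - 1) ∂(gaussianReal 0 1) = 0 := by
    rw [integral_sub (integrable_pow_gaussianReal 2) (integrable_const 1),
      integral_sq_gaussianReal]
    simp
  have hL2 : MemLp (fun x : ℝ => x ^ 2 - 1) 2 (gaussianReal 0 1) := by
    rw [memLp_two_iff_integrable_sq (by fun_prop)]
    have : (fun x : ℝ => (x ^ 2 - 1) ^ 2) = fun x => x ^ 4 - 2 * x ^ 2 + 1 := by
      funext x; ring
    rw [this]
    exact ((integrable_pow_gaussianReal 4).sub ((integrable_pow_gaussianReal 2).const_mul 2)).add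
      (integrable_const 1)
  have hsum : (∑ i, fun x : Fin p → ℝ => x i ^ 2 - 1) = fun x => ∑ i, (x i ^ 2 - 1) := by
    funext x; simp
  have hV := variance_sum_pi (μ := fun _ : Fin p => gaussianReal 0 1)
    (X := fun _ (x : ℝ) => x ^ 2 - 1) (fun _ => hL2)
  rw [variance_of_integral_eq_zero (by fun_prop) I2, variance_of_integral_eq_zero] at hV
  · rw [← map_pi_eq_stdGaussian, integral_map (by fun_prop)
      (Measurable.aestronglyMeasurable (by fun_prop))]
    calc _ = ∫ x : Fin p → ℝ, (1 / (p : ℝ)) ^ 2 * (∑ i, fun x : Fin p → ℝ => x i ^ 2 - 1) x ^ 2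
            ∂(Measure.pi fun _ => gaussianReal 0 1) := by
          congr 1
          funext x
          rw [norm_sq_div_eq_sum, ← mul_pow, Finset.sum_apply, Finset.sum_sub_distrib,
            ← Finset.mul_sum]
          congr 1
          simp only [Finset.sum_const, Finset.card_univ, Fintype.card_fin, nsmul_eq_mul]
          field_simp
      _ = _ := by
          rw [integral_const_mul, hV]
          simp only [Finset.sum_const, Finset.card_univ, Fintype.card_fin, nsmul_eq_mul]
          field_simp
  · rw [hsum]
    exact (Finset.measurable_fun_sum _ fun i _ => by fun_prop).aemeasurable
  · rw [hsum, integral_finsetSum]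
    · refine Finset.sum_eq_zero fun i _ => ?_
      rw [integral_comp_eval (μ := fun _ : Fin p => gaussianReal 0 1) (f := fun x : ℝ => x ^ 2 - 1)
        (by fun_prop), I2]
    · exact fun i _ => (measurePreserving_eval (fun _ : Fin p => gaussianReal 0 1)
        i).integrable_comp_of_integrable i2

/-- A bound for the moments of the noise that is uniform in the dimension. -/
def noiseMoment : ℝ :=
  512 * (1 + 4 * ∫ x, x ^ 8 ∂(gaussianReal 0 1)) + ∫ x, (x ^ 2 - 1) ^ 2 ∂(gaussianReal 0 1)

lemma noiseMoment_nonneg : 0 ≤ noiseMoment := by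
  have h1 : 0 ≤ ∫ x : ℝ, x ^ 8 ∂(gaussianReal 0 1) := integral_nonneg fun x => by positivity
  have h2 : 0 ≤ ∫ x : ℝ, (x ^ 2 - 1) ^ 2 ∂(gaussianReal 0 1) :=
    integral_nonneg fun x => by positivity
  unfold noiseMoment
  positivity

lemma size_pow_four_le {c g h A : ℝ} (hA : 0 ≤ A) :
    (1 + c ^ 2 + g ^ 2 + h ^ 2 + A) ^ 4 ≤ 512 * (1 + c ^ 8 + g ^ 8 + h ^ 8 + A ^ 4) := by
  have key : ∀ {a b : ℝ}, 0 ≤ a → 0 ≤ b → (a + b) ^ 4 ≤ 8 * (a ^ 4 + b ^ 4) := fun ha hb => by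
    simpa [show (2 : ℝ) ^ 3 = 8 by norm_num] using add_pow_le ha hb 4
  have h1 := key zero_le_one (sq_nonneg c)
  have h2 := key (sq_nonneg g) (sq_nonneg h)
  have h3 := key (by positivity : 0 ≤ 1 + c ^ 2) (by positivity : 0 ≤ g ^ 2 + h ^ 2)
  have h4 := key (by positivity : 0 ≤ (1 + c ^ 2) + (g ^ 2 + h ^ 2)) hA
  have hA4 : 0 ≤ A ^ 4 := by positivity
  have e : 1 + c ^ 2 + g ^ 2 + h ^ 2 + A = (1 + c ^ 2) + (g ^ 2 + h ^ 2) + A := by ring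
  rw [e]
  calc _ ≤ 8 * (8 * (8 * (1 ^ 4 + (c ^ 2) ^ 4) + 8 * ((g ^ 2) ^ 4 + (h ^ 2) ^ 4)) + A ^ 4) := by
        linarith
    _ ≤ 8 * (8 * (8 * (1 ^ 4 + (c ^ 2) ^ 4) + 8 * ((g ^ 2) ^ 4 + (h ^ 2) ^ 4)) + 64 * A ^ 4) := by
        linarith
    _ = _ := by ring

/-- The law of the noise `(c, a)` of one sample. -/
def noiseLaw (p : ℕ) : Measure (ℝ × EuclideanSpace ℝ (Fin p)) :=
  (gaussianReal 0 1).prod (stdGaussian _)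

instance : IsProbabilityMeasure (noiseLaw p) := by unfold noiseLaw; infer_instance

lemma stepNoise_noiseLaw (hp : 1 ≤ p) {v e : EuclideanSpace ℝ (Fin p)} (hv : ‖v‖ = 1)
    (he : ‖e‖ = 1) :
    StepNoise (noiseLaw p) (fun z => z.1) (fun z => inner ℝ v z.2) (fun z => inner ℝ e z.2)
      (fun z => ‖z.2‖ ^ 2 / p) p (inner ℝ v e) noiseMoment := by
  have hp0 : (p : ℝ) ≠ 0 := by positivity
  have j1 := (integrable_pow_gaussianReal 8).comp_fst (stdGaussian (EuclideanSpace ℝ (Fin p)))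
  have j2 := (integrable_inner_pow_stdGaussian hv 8).comp_snd (gaussianReal 0 1)
  have j3 := (integrable_inner_pow_stdGaussian he 8).comp_snd (gaussianReal 0 1)
  have j4 := (integrable_sum_coord_pow (p := p)).comp_snd (gaussianReal 0 1)
  have j01 := (integrable_const (1 : ℝ)).add j1
  have i1 := ((j01.add j2).add j3).add j4
  have hle : ∀ z : ℝ × EuclideanSpace ℝ (Fin p),
      (1 + z.1 ^ 2 + inner ℝ v z.2 ^ 2 + inner ℝ e z.2 ^ 2 + ‖z.2‖ ^ 2 / p) ^ 4
      ≤ 512 * (1 + z.1 ^ 8 + inner ℝ v z.2 ^ 8 + inner ℝ e z.2 ^ 8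
        + ∑ i, (1 / (p : ℝ)) * z.2 i ^ 8) := fun z => by
    refine (size_pow_four_le (by positivity)).trans ?_
    have := norm_sq_div_pow_four_le hp z.2
    gcongr
  have i2 : Integrable (fun z : ℝ × EuclideanSpace ℝ (Fin p) =>
      (1 + z.1 ^ 2 + inner ℝ v z.2 ^ 2 + inner ℝ e z.2 ^ 2 + ‖z.2‖ ^ 2 / p) ^ 4) (noiseLaw p) :=
    (i1.const_mul 512).mono' (by fun_prop) (ae_of_all _ fun z => by
      rw [Real.norm_eq_abs, abs_of_nonneg (by positivity)]; exact hle z)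
  refine ⟨by fun_prop, by fun_prop, by fun_prop, by fun_prop, by exact_mod_cast hp, ?_, ?_, i2, ?_,
    ?_, ?_, ?_, ?_, ?_, ?_⟩
  · have := abs_real_inner_le_norm v e
    rwa [hv, he, one_mul] at this
  · intro z
    have := abs_real_inner_le_norm e z.2
    rw [he, one_mul] at this
    rw [mul_div_cancel₀ _ hp0, ← sq_abs]
    exact pow_le_pow_left₀ (abs_nonneg _) this 2
  · refine (integral_mono i2 (i1.const_mul 512) hle).trans ?_
    have h2 : 0 ≤ ∫ x : ℝ, (x ^ 2 - 1) ^ 2 ∂(gaussianReal 0 1) :=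
      integral_nonneg fun x => by positivity
    rw [integral_const_mul]
    refine le_trans (le_of_eq ?_) (le_add_of_nonneg_right h2)
    congr 1
    refine (integral_add ((j01.add j2).add j3) j4).trans ?_
    rw [integral_add' (j01.add j2) j3, integral_add' j01 j2,
      integral_add' (integrable_const (1 : ℝ)) j1,
      integral_fun_fst (fun x : ℝ => x ^ 8), integral_fun_snd (fun a => inner ℝ v a ^ 8),
      integral_fun_snd (fun a => inner ℝ e a ^ 8),
      integral_fun_snd (fun a : EuclideanSpace ℝ (Fin p) => ∑ i, (1 / (p : ℝ)) * a i ^ 8),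
      integral_inner_pow_stdGaussian hv, integral_inner_pow_stdGaussian he,
      integral_sum_coord_pow hp]
    simp only [integral_const, probReal_univ, one_smul]
    ring
  · unfold noiseLaw
    rw [integral_fun_snd (fun a : EuclideanSpace ℝ (Fin p) => (‖a‖ ^ 2 / p - 1) ^ 2),
      integral_norm_sq_div_sub_one_sq hp]
    simp only [probReal_univ, one_smul]
    gcongr
    have h1 : 0 ≤ ∫ x : ℝ, x ^ 8 ∂(gaussianReal 0 1) := integral_nonneg fun x => by positivity
    unfold noiseMoment
    linarith
  · unfold noiseLaw
    rw [integral_fun_fst (fun x : ℝ => x ^ 2), integral_sq_gaussianReal]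
    simp
  · unfold noiseLaw
    rw [integral_fun_snd (fun a => inner ℝ v a ^ 2), integral_inner_pow_stdGaussian hv,
      integral_sq_gaussianReal]
    simp
  · unfold noiseLaw
    rw [integral_prod_mul (fun x : ℝ => x) (fun a => inner ℝ v a), integral_inner_stdGaussian,
      mul_zero]
  · unfold noiseLaw
    rw [integral_prod_mul (fun x : ℝ => x) (fun a => inner ℝ e a), integral_inner_stdGaussian,
      mul_zero]
  · unfold noiseLaw
    rw [integral_fun_snd (fun a => inner ℝ v a * inner ℝ e a),
      integral_inner_mul_inner_stdGaussian]
    simp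

/-! ### The cosine similarity after one step -/

lemma etaMap_zero (x : EuclideanSpace ℝ (Fin p)) : etaMap p (fun _ => 0) x = x := by
  ext i
  simp [etaMap]

lemma cosineSim_smul {r : ℝ} (hr : 0 < r) (x ξ : EuclideanSpace ℝ (Fin p)) :
    cosineSim (r • x) ξ = cosineSim x ξ := by
  unfold cosineSim
  rw [inner_smul_left, norm_smul, Real.norm_of_nonneg hr.le]
  simp only [conj_trivial]
  rw [mul_assoc, mul_div_mul_left _ _ hr.ne']

lemma cosineSim_eq_inner (x ξ : EuclideanSpace ℝ (Fin p)) :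
    cosineSim x ξ = inner ℝ (‖x‖⁻¹ • x) (‖ξ‖⁻¹ • ξ) := by
  rw [inner_smul_left, inner_smul_right]
  simp only [cosineSim, conj_trivial]
  rw [div_eq_mul_inv, mul_inv]; ring

lemma oja_update_ne_zero {τ : ℝ} (hτ : 0 ≤ τ) {x : EuclideanSpace ℝ (Fin p)} (hx : x ≠ 0)
    (y : EuclideanSpace ℝ (Fin p)) : x + (τ / p * inner ℝ y x) • y ≠ 0 := by
  intro h
  have h1 : inner ℝ (x + (τ / p * inner ℝ y x) • y) x = ‖x‖ ^ 2 + τ / p * inner ℝ y x ^ 2 := by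
    rw [inner_add_left, inner_smul_left, real_inner_self_eq_norm_sq]
    simp only [conj_trivial]; ring
  rw [h, inner_zero_left] at h1
  have h2 : 0 < ‖x‖ ^ 2 := by positivity
  have h3 : 0 ≤ τ / p * inner ℝ y x ^ 2 := by positivity
  linarith

lemma ojaStep_ne_zero (hp : 1 ≤ p) {τ : ℝ} (hτ : 0 ≤ τ) {x : EuclideanSpace ℝ (Fin p)}
    (hx : x ≠ 0) (y : EuclideanSpace ℝ (Fin p)) : onlineStep p τ (fun _ => 0) y x ≠ 0 := by
  unfold onlineStep
  rw [etaMap_zero]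
  have h := oja_update_ne_zero hτ hx y
  have hp0 : (0 : ℝ) < p := by positivity
  exact smul_ne_zero (div_pos (Real.sqrt_pos.2 hp0) (norm_pos_iff.2 h)).ne' h

/-- The effect of a step of Oja's method depends on the iterate through its direction only. -/
lemma cosineSim_ojaStep (hp : 1 ≤ p) {τ ω : ℝ} (hτ : 0 ≤ τ)
    {x ξ : EuclideanSpace ℝ (Fin p)} (hx : x ≠ 0) (hξ : ξ ≠ 0) (c : ℝ)
    (a : EuclideanSpace ℝ (Fin p)) :
    cosineSim (onlineStep p τ (fun _ => 0) (spikedSample p ω ξ c a) x) ξ =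
      noisyCosine τ p (cosineSim x ξ) (Real.sqrt (ω / p) * ‖ξ‖) c (inner ℝ (‖x‖⁻¹ • x) a)
        (inner ℝ (‖ξ‖⁻¹ • ξ) a) (‖a‖ ^ 2 / p) := by
  have hp0 : (0 : ℝ) < p := by positivity
  have hx0 : 0 < ‖x‖ := norm_pos_iff.2 hx
  have hξ0 : 0 < ‖ξ‖ := norm_pos_iff.2 hξ
  unfold onlineStep
  rw [etaMap_zero]
  have hw := oja_update_ne_zero hτ hx (spikedSample p ω ξ c a)
  rw [cosineSim_smul (div_pos (Real.sqrt_pos.2 hp0) (norm_pos_iff.2 hw))]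
  obtain ⟨y, hy⟩ : ∃ y, y = spikedSample p ω ξ c a := ⟨_, rfl⟩
  have hyx : inner ℝ y x = ‖x‖ * (Real.sqrt (ω / p) * ‖ξ‖ * c * cosineSim x ξ
      + inner ℝ (‖x‖⁻¹ • x) a) := by
    rw [hy, spikedSample, inner_add_left, inner_smul_left, inner_smul_left, real_inner_comm x ξ,
      real_inner_comm x a, cosineSim]
    simp only [conj_trivial]
    field_simp
  have hyξ : inner ℝ y ξ = ‖ξ‖ * (Real.sqrt (ω / p) * ‖ξ‖ * c + inner ℝ (‖ξ‖⁻¹ • ξ) a) := by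
    rw [hy, spikedSample, inner_add_left, inner_smul_left, inner_smul_left,
      real_inner_self_eq_norm_sq, real_inner_comm ξ a]
    simp only [conj_trivial]
    field_simp
  have hyy : ‖y‖ ^ 2 / p = ((Real.sqrt (ω / p) * ‖ξ‖) ^ 2 * c ^ 2
      + 2 * (Real.sqrt (ω / p) * ‖ξ‖) * c * inner ℝ (‖ξ‖⁻¹ • ξ) a) / p + ‖a‖ ^ 2 / p := by
    rw [hy, spikedSample, norm_add_sq_real, norm_smul, inner_smul_left, inner_smul_left,
      Real.norm_eq_abs, mul_pow, sq_abs]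
    simp only [conj_trivial]
    field_simp
  rw [← hy]
  unfold noisyCosine nextCosine
  rw [← hyy]
  set s := Real.sqrt (ω / p) * ‖ξ‖ * c * cosineSim x ξ + inner ℝ (‖x‖⁻¹ • x) a
  set b := Real.sqrt (ω / p) * ‖ξ‖ * c + inner ℝ (‖ξ‖⁻¹ • ξ) a
  have hn : ‖x + (τ / p * inner ℝ y x) • y‖ ^ 2
      = ‖x‖ ^ 2 * (1 + s ^ 2 / p * (2 * τ + τ ^ 2 * (‖y‖ ^ 2 / p))) := by
    rw [norm_add_sq_real, norm_smul, inner_smul_right, real_inner_comm y x, hyx, Real.norm_eq_abs,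
      mul_pow, sq_abs]
    field_simp
    ring
  have hn' : ‖x + (τ / p * inner ℝ y x) • y‖
      = ‖x‖ * Real.sqrt (1 + s ^ 2 / p * (2 * τ + τ ^ 2 * (‖y‖ ^ 2 / p))) := by
    rw [← Real.sqrt_sq (norm_nonneg (x + (τ / p * inner ℝ y x) • y)), hn,
      Real.sqrt_mul (sq_nonneg _), Real.sqrt_sq hx0.le]
  have hpos : 0 < Real.sqrt (1 + s ^ 2 / p * (2 * τ + τ ^ 2 * (‖y‖ ^ 2 / p))) :=
    Real.sqrt_pos.2 (by positivity)
  conv_lhs => rw [cosineSim]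
  rw [hn', inner_add_left, inner_smul_left, hyx, hyξ]
  have hq : inner ℝ x ξ = ‖x‖ * ‖ξ‖ * cosineSim x ξ := by
    rw [cosineSim]; field_simp
  rw [hq]
  simp only [conj_trivial]
  field_simp

end

noncomputable section

/-! ### The length of the signal -/

lemma isProbabilityMeasure_sparsePrior {ρ : ℝ} (hρ : 0 ≤ ρ) (hρ1 : ρ ≤ 1) (u : Measure ℝ)
    [IsProbabilityMeasure u] : IsProbabilityMeasure (sparsePrior ρ u) := by
  refine ⟨?_⟩
  simp only [sparsePrior, Measure.coe_add, Measure.coe_smul, Pi.add_apply, Pi.smul_apply,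
    measure_univ, smul_eq_mul, mul_one]
  rw [← ENNReal.ofReal_add (by linarith) hρ]
  simp

lemma integrable_sq_sparsePrior (ρ : ℝ) {u : Measure ℝ}
    (hu : Integrable (fun x : ℝ => x ^ 2) u) :
    Integrable (fun x : ℝ => x ^ 2) (sparsePrior ρ u) :=
  ((integrable_dirac (by simp)).smul_measure ENNReal.ofReal_ne_top).add_measure
    (hu.smul_measure ENNReal.ofReal_ne_top)

lemma integral_sq_sparsePrior {ρ : ℝ} (hρ : 0 < ρ) {u : Measure ℝ}
    (hu_int : Integrable (fun x : ℝ => x ^ 2) u) (hu : ∫ x, x ^ 2 ∂u = 1 / ρ) :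
    ∫ x, x ^ 2 ∂(sparsePrior ρ u) = 1 := by
  rw [sparsePrior, integral_add_measure
    ((integrable_dirac (by simp)).smul_measure ENNReal.ofReal_ne_top)
    (hu_int.smul_measure ENNReal.ofReal_ne_top), integral_smul_measure, integral_smul_measure,
    integral_dirac, hu, ENNReal.toReal_ofReal hρ.le]
  simp [hρ.ne']

/-- The joint law of finitely many i.i.d. variables is their product law, whatever the probability
space. This allows the law of large numbers to be transferred between different spaces. -/
lemma measure_iid_preimage {Ω : Type*} [MeasurableSpace Ω] {P : Measure Ω} {π : Measure ℝ}
    {p : ℕ} {X : Fin p → Ω → ℝ} (hX : ∀ i, Measurable (X i))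
    (hlaw : ∀ i, P.map (X i) = π) (hind : iIndepFun X P) {S : Set (Fin p → ℝ)}
    (hS : MeasurableSet S) : P {s | (fun i => X i s) ∈ S} = Measure.pi (fun _ : Fin p => π) S := by
  have : IsProbabilityMeasure P := hind.isProbabilityMeasure
  have h := (iIndepFun_iff_map_fun_eq_pi_map fun i => (hX i).aemeasurable).1 hind
  simp only [hlaw] at h
  rw [← h, Measure.map_apply (by fun_prop) hS]
  rfl

/-- The weak law of large numbers for the squared length of vectors with i.i.d. entries, living on
possibly different probability spaces. -/
theorem tendsto_measure_norm_sq_div_sub_one {Ω : ℕ → Type*} [∀ p, MeasurableSpace (Ω p)]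
    {P : ∀ p, Measure (Ω p)} {π : Measure ℝ} [IsProbabilityMeasure π]
    (hint : Integrable (fun x : ℝ => x ^ 2) π) (hπ : ∫ x, x ^ 2 ∂π = 1)
    {ξ : ∀ p, Ω p → EuclideanSpace ℝ (Fin p)} (hξ : ∀ p, Measurable (ξ p))
    (hlaw : ∀ p i, (P p).map (fun s => ξ p s i) = π)
    (hind : ∀ p, iIndepFun (fun (i : Fin p) s => ξ p s i) (P p)) {ε : ℝ} (hε : 0 < ε) :
    Tendsto (fun p => P p {s | ε ≤ |‖ξ p s‖ ^ 2 / p - 1|}) atTop (𝓝 0) := by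
  set ν : Measure (ℕ → ℝ) := Measure.infinitePi (fun _ => π)
  have hmap : ∀ i, ν.map (fun x => x i) = π := fun i =>
    Measure.infinitePi_map_eval (fun _ : ℕ => π) i
  have hindν : iIndepFun (fun (i : ℕ) (x : ℕ → ℝ) => x i) ν := by
    rw [iIndepFun_iff_map_fun_eq_infinitePi_map (by fun_prop)]
    simp only [hmap]
    exact Measure.map_id
  have hindsq : iIndepFun (fun (i : ℕ) (x : ℕ → ℝ) => x i ^ 2) ν :=
    hindν.comp (fun _ y => y ^ 2) fun _ => by fun_prop
  have hmp : ∀ i, MeasurePreserving (fun x : ℕ → ℝ => x i) ν π := fun i => ⟨by fun_prop, hmap i⟩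
  have hslln := strong_law_ae_real (μ := ν) (fun i x => x i ^ 2)
    ((hmp 0).integrable_comp_of_integrable hint)
    (fun i j hij => hindsq.indepFun hij)
    (fun i => IdentDistrib.comp (u := fun y : ℝ => y ^ 2)
      ⟨(measurable_pi_apply i).aemeasurable, (measurable_pi_apply 0).aemeasurable,
        by rw [hmap, hmap]⟩ (by fun_prop))
  have h1 : ∫ x : ℕ → ℝ, x 0 ^ 2 ∂ν = 1 := by
    rw [← hπ, ← hmap 0, integral_map (measurable_pi_apply 0).aemeasurable (by fun_prop)]
  rw [h1] at hslln
  have hmeas := tendstoInMeasure_of_tendsto_ae (μ := ν)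
    (fun n => Measurable.aestronglyMeasurable (by fun_prop)) hslln
  rw [tendstoInMeasure_iff_dist] at hmeas
  refine (hmeas ε hε).congr fun p => ?_
  have hS : MeasurableSet {x : Fin p → ℝ | ε ≤ |(∑ i, x i ^ 2) / p - 1|} :=
    measurableSet_le measurable_const (by fun_prop)
  have e1 := measure_iid_preimage (P := ν) (X := fun (i : Fin p) x => x i) (by fun_prop)
    (fun i => hmap i) (hindν.precomp Fin.val_injective) hS
  have e2 := measure_iid_preimage (P := P p) (X := fun (i : Fin p) s => ξ p s i)
    (fun i => by have := hξ p; fun_prop) (hlaw p) (hind p) hS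
  rw [← e2] at e1
  convert e1 using 2
  · ext x
    simp only [Set.mem_ofPred_eq, Real.dist_eq]
    rw [Finset.sum_range]
  · ext s
    simp only [Set.mem_ofPred_eq]
    rw [EuclideanSpace.norm_sq_eq]
    simp
end

noncomputable section

/-! ### A maximal inequality -/

/-- A maximal inequality for a process `V` that is nearly a supermartingale as long as it stays
below the level `l`. Stopping is built in: only the values of `V` up to the first passage above
`l` enter the hypothesis. -/
theorem maximal_inequality {Ω : Type*} [MeasurableSpace Ω] {μ : Measure Ω} {V : ℕ → Ω → ENNReal}
    (hV : ∀ k, Measurable (V k)) {G : Set Ω} (hG : MeasurableSet G) {l β κ : ENNReal}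
    (hβ : 1 ≤ β) {n : ℕ}
    (h : ∀ k < n, ∫⁻ s in {s | s ∈ G ∧ ∀ j ≤ k, V j s < l}, V (k + 1) s ∂μ
      ≤ β * ∫⁻ s in {s | s ∈ G ∧ ∀ j ≤ k, V j s < l}, V k s ∂μ + κ) :
    l * μ {s | s ∈ G ∧ ∃ k ≤ n, l ≤ V k s} ≤ β ^ n * (∫⁻ s in G, V 0 s ∂μ + n * κ) := by
  -- splitting a set according to the level of `V`
  have split : ∀ (D : Set Ω) (k : ℕ), MeasurableSet D →
      l * μ (D ∩ {s | l ≤ V k s}) + ∫⁻ s in D ∩ {s | V k s < l}, V k s ∂μ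
        ≤ ∫⁻ s in D, V k s ∂μ := fun D k hD => by
    have hm : MeasurableSet {s | l ≤ V k s} := measurableSet_le measurable_const (hV k)
    have e : D \ {s | l ≤ V k s} = D ∩ {s | V k s < l} := by
      ext s; simp
    rw [← lintegral_inter_add_sdiff (V k) D hm, e]
    gcongr
    rw [← setLIntegral_const]
    exact setLIntegral_mono (hV k) fun s hs => hs.2
  have hD : ∀ k, MeasurableSet {s | s ∈ G ∧ ∀ j ≤ k, V j s < l} := fun k => by
    have : {s | s ∈ G ∧ ∀ j ≤ k, V j s < l} = G ∩ ⋂ j ≤ k, {s | V j s < l} := by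
      ext s; simp
    rw [this]
    exact hG.inter (MeasurableSet.iInter fun j => MeasurableSet.iInter fun _ =>
      measurableSet_lt (hV j) measurable_const)
  have key : ∀ k ≤ n, l * μ {s | s ∈ G ∧ ∃ j ≤ k, l ≤ V j s}
      + ∫⁻ s in {s | s ∈ G ∧ ∀ j ≤ k, V j s < l}, V k s ∂μ
      ≤ β ^ k * (∫⁻ s in G, V 0 s ∂μ + k * κ) := by
    intro k
    induction k with
    | zero =>
      intro _
      have := split G 0 hG
      simpa [Set.ofPred_and] using this
    | succ k ih =>
      intro hk
      set D := {s | s ∈ G ∧ ∀ j ≤ k, V j s < l} with hDdef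
      have e1 : {s | s ∈ G ∧ ∀ j ≤ k + 1, V j s < l} = D ∩ {s | V (k + 1) s < l} := by
        ext s
        simp only [hDdef, Set.mem_ofPred_eq, Set.mem_inter_iff]
        constructor
        · exact fun hs => ⟨⟨hs.1, fun j hj => hs.2 j (by omega)⟩, hs.2 _ le_rfl⟩
        · rintro ⟨⟨h1, h2⟩, h3⟩
          refine ⟨h1, fun j hj => ?_⟩
          rcases Nat.lt_or_ge k j with hj' | hj'
          · obtain rfl : j = k + 1 := by omega
            exact h3
          · exact h2 j hj'
      have e2 : {s | s ∈ G ∧ ∃ j ≤ k + 1, l ≤ V j s}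
          ⊆ {s | s ∈ G ∧ ∃ j ≤ k, l ≤ V j s} ∪ (D ∩ {s | l ≤ V (k + 1) s}) := by
        rintro s ⟨hs, j, hj, hlj⟩
        by_cases hex : ∃ i ≤ k, l ≤ V i s
        · exact Or.inl ⟨hs, hex⟩
        · push Not at hex
          have : j = k + 1 := by
            by_contra hne
            exact absurd (hex j (by omega)) (not_lt.2 hlj)
          exact Or.inr ⟨⟨hs, hex⟩, this ▸ hlj⟩
      rw [e1]
      calc _ ≤ l * (μ {s | s ∈ G ∧ ∃ j ≤ k, l ≤ V j s} + μ (D ∩ {s | l ≤ V (k + 1) s}))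
            + ∫⁻ s in D ∩ {s | V (k + 1) s < l}, V (k + 1) s ∂μ := by
            gcongr
            exact (measure_mono e2).trans (measure_union_le _ _)
        _ = l * μ {s | s ∈ G ∧ ∃ j ≤ k, l ≤ V j s} + (l * μ (D ∩ {s | l ≤ V (k + 1) s})
            + ∫⁻ s in D ∩ {s | V (k + 1) s < l}, V (k + 1) s ∂μ) := by ring
        _ ≤ l * μ {s | s ∈ G ∧ ∃ j ≤ k, l ≤ V j s} + (β * ∫⁻ s in D, V k s ∂μ + κ) := by
            exact add_le_add_right ((split D (k + 1) (hD k)).trans (h k (by omega))) _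
        _ ≤ β * (l * μ {s | s ∈ G ∧ ∃ j ≤ k, l ≤ V j s}) + (β * ∫⁻ s in D, V k s ∂μ + κ) := by
            exact add_le_add_left (le_mul_of_one_le_left zero_le hβ) _
        _ = β * (l * μ {s | s ∈ G ∧ ∃ j ≤ k, l ≤ V j s} + ∫⁻ s in D, V k s ∂μ) + κ := by ring
        _ ≤ β * (β ^ k * (∫⁻ s in G, V 0 s ∂μ + k * κ)) + β ^ (k + 1) * κ := by
            gcongr
            · exact ih (by omega)
            · exact le_mul_of_one_le_left zero_le (one_le_pow₀ hβ)
        _ = _ := by push_cast; ring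
  exact le_self_add.trans (key n le_rfl)

/-! ### Independence of the past and the next sample -/

lemma IndepFun.prodMk_left_of_indepFun {Ω A B C : Type*} [MeasurableSpace Ω] [MeasurableSpace A]
    [MeasurableSpace B] [MeasurableSpace C] {μ : Measure Ω} [IsProbabilityMeasure μ] {X : Ω → A}
    {Y : Ω → B} {Z : Ω → C} (hX : Measurable X) (hY : Measurable Y) (hZ : Measurable Z)
    (h : IndepFun X (fun s => (Y s, Z s)) μ) (h' : IndepFun Y Z μ) :
    IndepFun (fun s => (X s, Y s)) Z μ := by
  have hXY : IndepFun X Y μ := h.comp (φ := id) (ψ := Prod.fst) measurable_id measurable_fst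
  rw [indepFun_iff_map_prod_eq_prod_map_map (by fun_prop) (by fun_prop)] at h h' hXY ⊢
  rw [hXY]
  have := Measure.isProbabilityMeasure_map (μ := μ) hX.aemeasurable
  have := Measure.isProbabilityMeasure_map (μ := μ) hY.aemeasurable
  have := Measure.isProbabilityMeasure_map (μ := μ) hZ.aemeasurable
  rw [h'] at h
  have e : (fun s => ((X s, Y s), Z s)) = MeasurableEquiv.prodAssoc.symm ∘
      fun s => (X s, (Y s, Z s)) := rfl
  rw [e, ← Measure.map_map (by fun_prop) (by fun_prop), h, ← Measure.prodAssoc_prod,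
    Measure.map_map (by fun_prop) (by fun_prop)]
  simp

/-- The noises up to time `k`, together with the initial data, are independent of the noise at
time `k`. -/
lemma indepFun_past {Ω A B : Type*} [MeasurableSpace Ω] [MeasurableSpace A] [MeasurableSpace B]
    [Zero B] {μ : Measure Ω} [IsProbabilityMeasure μ] {X : Ω → A} {N : ℕ → Ω → B}
    (hX : Measurable X) (hN : ∀ k, Measurable (N k)) (hind : iIndepFun N μ)
    (hinit : IndepFun X (fun s k => N k s) μ) (k : ℕ) :
    IndepFun (fun s => (X s, fun j => if j < k then N j s else 0)) (N k) μ := by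
  have mT : Measurable (fun (n : ℕ → B) (j : ℕ) => if j < k then n j else 0) := by
    refine measurable_pi_lambda _ fun j => ?_
    split_ifs <;> fun_prop
  have hi : IndepFun X (fun s => ((fun j => if j < k then N j s else 0), N k s)) μ :=
    hinit.comp (φ := id) (ψ := fun n : ℕ → B => ((fun j => if j < k then n j else 0), n k))
      measurable_id (mT.prodMk (measurable_pi_apply k))
  have hn : IndepFun (fun s j => if j < k then N j s else 0) (N k) μ := by
    have h0 := hind.indepFun_finset (Finset.range k) {k} (by simp) hN
    have mφ : Measurable (fun (n : Finset.range k → B) (j : ℕ) =>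
        if hj : j < k then n ⟨j, Finset.mem_range.2 hj⟩ else 0) := by
      refine measurable_pi_lambda _ fun j => ?_
      split_ifs <;> fun_prop
    exact h0.comp mφ (measurable_pi_apply (⟨k, by simp⟩ : ({k} : Finset ℕ)))
  exact IndepFun.prodMk_left_of_indepFun hX (mT.comp (measurable_pi_lambda _ hN)) (hN k) hi hn

/-- The data of a run of the algorithm: the pair of the initial estimate and the signal, and the
sequence of the noises of the samples. -/
abbrev RunData (p : ℕ) : Type :=
  (EuclideanSpace ℝ (Fin p) × EuclideanSpace ℝ (Fin p)) × (ℕ → ℝ × EuclideanSpace ℝ (Fin p))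

variable {p : ℕ}

/-- The part of the data known before sample number `k`: the later noises are replaced by `0`. -/
def RunData.past (k : ℕ) (w : RunData p) : RunData p :=
  (w.1, fun j => if j < k then w.2 j else 0)

lemma RunData.measurable_past (k : ℕ) : Measurable (RunData.past (p := p) k) := by
  refine measurable_fst.prodMk (measurable_pi_lambda _ fun j => ?_)
  split_ifs <;> fun_prop

/-- The iterates of Oja's method as a function of the data. -/
def RunData.iter (τ ω : ℝ) (k : ℕ) (w : RunData p) : EuclideanSpace ℝ (Fin p) :=
  ojaIter p τ (fun k => spikedSample p ω w.1.2 (w.2 k).1 (w.2 k).2) w.1.1 k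

/-- The cosine similarity of the iterates and the signal as a function of the data. -/
def RunData.cosine (τ ω : ℝ) (k : ℕ) (w : RunData p) : ℝ :=
  cosineSim (RunData.iter τ ω k w) w.1.2

lemma RunData.iter_succ (τ ω : ℝ) (k : ℕ) (w : RunData p) :
    RunData.iter τ ω (k + 1) w = onlineStep p τ (fun _ => 0)
      (spikedSample p ω w.1.2 (w.2 k).1 (w.2 k).2) (RunData.iter τ ω k w) := rfl

@[simp]
lemma RunData.past_fst (k : ℕ) (w : RunData p) : (w.past k).1 = w.1 := rfl

lemma RunData.cosine_zero (τ ω : ℝ) (w : RunData p) :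
    RunData.cosine τ ω 0 w = cosineSim w.1.1 w.1.2 := rfl

/-- The cosine similarity after one more step, with the noise `z` in the new sample. -/
def RunData.nextStep (τ ω : ℝ) (k : ℕ) (w : RunData p) (z : ℝ × EuclideanSpace ℝ (Fin p)) : ℝ :=
  cosineSim (onlineStep p τ (fun _ => 0) (spikedSample p ω w.1.2 z.1 z.2)
    (RunData.iter τ ω k w)) w.1.2

lemma RunData.cosine_succ (τ ω : ℝ) (k : ℕ) (w : RunData p) :
    RunData.cosine τ ω (k + 1) w = RunData.nextStep τ ω k w (w.2 k) := rfl

lemma RunData.iter_past (τ ω : ℝ) {j k : ℕ} (hjk : j ≤ k) (w : RunData p) :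
    RunData.iter τ ω j (w.past k) = RunData.iter τ ω j w := by
  induction j with
  | zero => rfl
  | succ j ih =>
    rw [RunData.iter_succ, RunData.iter_succ, ih (by omega)]
    simp [RunData.past, Nat.lt_of_succ_le hjk]

lemma RunData.cosine_past (τ ω : ℝ) {j k : ℕ} (hjk : j ≤ k) (w : RunData p) :
    RunData.cosine τ ω j (w.past k) = RunData.cosine τ ω j w := by
  rw [RunData.cosine, RunData.iter_past τ ω hjk, RunData.cosine, RunData.past_fst]

lemma RunData.nextStep_past (τ ω : ℝ) (k : ℕ) (w : RunData p)
    (z : ℝ × EuclideanSpace ℝ (Fin p)) :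
    RunData.nextStep τ ω k (w.past k) z = RunData.nextStep τ ω k w z := by
  rw [RunData.nextStep, RunData.iter_past τ ω le_rfl, RunData.nextStep, RunData.past_fst]

lemma measurable_ojaStep (τ ω : ℝ) :
    Measurable (fun z : (EuclideanSpace ℝ (Fin p) × EuclideanSpace ℝ (Fin p))
      × (ℝ × EuclideanSpace ℝ (Fin p)) =>
      onlineStep p τ (fun _ => 0) (spikedSample p ω z.1.2 z.2.1 z.2.2) z.1.1) := by
  unfold onlineStep spikedSample
  simp only [etaMap_zero]
  fun_prop

lemma measurable_cosineSim :
    Measurable (fun z : EuclideanSpace ℝ (Fin p) × EuclideanSpace ℝ (Fin p) =>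
      cosineSim z.1 z.2) := by
  unfold cosineSim
  fun_prop

lemma RunData.measurable_iter (τ ω : ℝ) (k : ℕ) : Measurable (RunData.iter (p := p) τ ω k) := by
  induction k with
  | zero =>
    change Measurable (fun w : RunData p => w.1.1)
    fun_prop
  | succ k ih =>
    have h : Measurable (fun w : RunData p => ((RunData.iter τ ω k w, w.1.2), w.2 k)) := by
      fun_prop
    change Measurable (fun w : RunData p => RunData.iter τ ω (k + 1) w)
    simp only [RunData.iter_succ]
    have h' := (measurable_ojaStep τ ω).comp h
    simpa only [Function.comp_def] using h'

lemma RunData.measurable_cosine (τ ω : ℝ) (k : ℕ) :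
    Measurable (RunData.cosine (p := p) τ ω k) :=
  measurable_cosineSim.comp ((RunData.measurable_iter τ ω k).prodMk measurable_fst.snd)

lemma RunData.measurable_nextStep (τ ω : ℝ) (k : ℕ) :
    Measurable (fun y : RunData p × (ℝ × EuclideanSpace ℝ (Fin p)) =>
      RunData.nextStep τ ω k y.1 y.2) := by
  have h1 : Measurable (fun y : RunData p × (ℝ × EuclideanSpace ℝ (Fin p)) =>
      ((RunData.iter τ ω k y.1, y.1.1.2), y.2)) := by
    have := RunData.measurable_iter (p := p) τ ω k
    fun_prop
  have h2 := (measurable_ojaStep (p := p) τ ω).comp h1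
  have h3 : Measurable (fun y : RunData p × (ℝ × EuclideanSpace ℝ (Fin p)) => y.1.1.2) := by
    fun_prop
  have h4 := measurable_cosineSim.comp (h2.prodMk h3)
  simpa only [Function.comp_def, RunData.nextStep] using h4

lemma RunData.iter_ne_zero (hp : 1 ≤ p) {τ : ℝ} (hτ : 0 ≤ τ) (ω : ℝ) {w : RunData p}
    (hw : w.1.1 ≠ 0) (k : ℕ) : RunData.iter τ ω k w ≠ 0 := by
  induction k with
  | zero => exact hw
  | succ k ih => exact ojaStep_ne_zero hp hτ ih _

/-- A law of the data under which the noise of each sample has the law `noiseLaw p` and is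
independent of the past. -/
structure RunData.FreshNoise (m : Measure (RunData p)) : Prop where
  map_eq : ∀ k, m.map (fun w => (w.past k, w.2 k)) = (m.map (RunData.past k)).prod (noiseLaw p)

/-- In the spiked model the data have fresh noise at each step, so that all estimates can be carried
out on the space `RunData p`. -/
lemma IsSpikedModel.freshNoise {Ω : Type*} [MeasurableSpace Ω] {P : Measure Ω}
    [IsProbabilityMeasure P] {π : Measure ℝ} {ξ x₀ : Ω → EuclideanSpace ℝ (Fin p)} {c : ℕ → Ω → ℝ}
    {a : ℕ → Ω → EuclideanSpace ℝ (Fin p)} (h : IsSpikedModel P p π ξ x₀ c a) :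
    Measurable (fun s => ((x₀ s, ξ s), fun k => (c k s, a k s))) ∧
    RunData.FreshNoise (P.map (fun s => ((x₀ s, ξ s), fun k => (c k s, a k s)))) := by
  have mξ := h.measurable_ξ
  have mx := h.measurable_x₀
  have mc := h.measurable_c
  have ma := h.measurable_a
  have mN : ∀ k, Measurable (fun s => (c k s, a k s)) := fun k => by fun_prop
  have mNs : Measurable (fun s k => (c k s, a k s)) := measurable_pi_lambda _ mN
  have mZ : Measurable (fun s => ((x₀ s, ξ s), fun k => (c k s, a k s))) :=
    (mx.prodMk mξ).prodMk mNs
  refine ⟨mZ, ⟨fun k => ?_⟩⟩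
  have hind := indepFun_past (mx.prodMk mξ) mN h.noise_indep h.init_indep k
  have mW : Measurable (fun s => ((x₀ s, ξ s), fun j => if j < k then (c j s, a j s) else 0)) :=
    (RunData.measurable_past k).comp mZ
  rw [indepFun_iff_map_prod_eq_prod_map_map mW.aemeasurable (mN k).aemeasurable] at hind
  have hlaw : P.map (fun s => (c k s, a k s)) = noiseLaw p := by
    have := (indepFun_iff_map_prod_eq_prod_map_map (mc k).aemeasurable
      (ma k).aemeasurable).1 (h.c_a_indep k)
    rw [this, h.c_law, h.a_law]
    rfl
  rw [hlaw] at hind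
  rw [Measure.map_map ((RunData.measurable_past k).prodMk (by fun_prop)) mZ,
    Measure.map_map (RunData.measurable_past k) mZ]
  exact hind

/-- Integrating out the noise of the next sample. -/
lemma RunData.FreshNoise.lintegral_eq {m : Measure (RunData p)}
    (hm : RunData.FreshNoise m) (k : ℕ)
    {F : RunData p → ℝ × EuclideanSpace ℝ (Fin p) → ENNReal} (hF : Measurable (Function.uncurry F)) :
    ∫⁻ w, F (w.past k) (w.2 k) ∂m = ∫⁻ w, ∫⁻ z, F (w.past k) z ∂(noiseLaw p) ∂m := by
  have h1 : ∫⁻ w, F (w.past k) (w.2 k) ∂m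
      = ∫⁻ y, Function.uncurry F y ∂(m.map (fun w => (w.past k, w.2 k))) := by
    rw [lintegral_map hF ((RunData.measurable_past k).prodMk (by fun_prop))]
    rfl
  rw [h1, hm.map_eq k, lintegral_prod _ hF.aemeasurable, lintegral_map
    (hF.lintegral_prod_right') (RunData.measurable_past k)]
  rfl

/-- Conditioning on the past: on an event `D` decided before sample number `k`, a bound for the mean
over the fresh noise gives a bound for the mean over the data. -/
lemma RunData.FreshNoise.setLIntegral_cosine_succ_le {m : Measure (RunData p)}
    (hm : RunData.FreshNoise m) {k : ℕ} {D : Set (RunData p)} (hD : MeasurableSet D)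
    (hpast : ∀ w, w.past k ∈ D ↔ w ∈ D) {τ ω Q : ℝ} {f : RunData p → ENNReal}
    (hf : ∀ w ∈ D, ∫⁻ z, ENNReal.ofReal ((RunData.nextStep τ ω k w z - Q) ^ 2) ∂(noiseLaw p)
      ≤ f w) :
    ∫⁻ w in D, ENNReal.ofReal ((RunData.cosine τ ω (k + 1) w - Q) ^ 2) ∂m ≤ ∫⁻ w in D, f w ∂m := by
  classical
  have mS := RunData.measurable_nextStep (p := p) τ ω k
  simp only [RunData.cosine_succ]
  generalize hS : RunData.nextStep (p := p) τ ω k = S at *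
  have hSpast : ∀ w z, S (w.past k) z = S w z := fun w z => by
    rw [← hS]; exact RunData.nextStep_past τ ω k w z
  have mF : Measurable (Function.uncurry fun (w : RunData p) z =>
      D.indicator (fun w => ENNReal.ofReal ((S w z - Q) ^ 2)) w) :=
    (((mS.sub_const Q).pow_const 2).ennreal_ofReal).indicator (measurable_fst hD)
  have h := hm.lintegral_eq k
    (F := fun w z => D.indicator (fun w => ENNReal.ofReal ((S w z - Q) ^ 2)) w) mF
  simp only [Set.indicator_apply, hpast, hSpast] at h
  simp only [← lintegral_indicator hD, Set.indicator_apply]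
  rw [h]
  refine lintegral_mono fun w => ?_
  by_cases hw : w ∈ D
  · simpa only [hw, if_true] using hf w hw
  · simp [hw]

end

noncomputable section

/-! ### Convergence of the cosine similarity -/

/-- One step of the Lyapunov estimate, given the iterate and the signal. -/
lemma exists_lintegral_ojaStep_le (τ ω L : ℝ) (hτ : 0 < τ) (hω : 0 < ω) :
    ∃ B, 0 ≤ B ∧ ∀ (p : ℕ) (x ξ : EuclideanSpace ℝ (Fin p)) (δ Q Q' : ℝ), 1 ≤ p → x ≠ 0 → ξ ≠ 0 →
      |‖ξ‖ ^ 2 / p - 1| ≤ δ → δ ≤ 1 → |Q' - Q| ≤ L / p →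
      |Q' - Q - (-(τ * ω * (1 + τ / 2)) * Q ^ 3 + τ * (ω - τ / 2) * Q) / p| ≤ L / (p : ℝ) ^ 2 →
      ∫⁻ z, ENNReal.ofReal ((cosineSim (onlineStep p τ (fun _ => 0)
        (spikedSample p ω ξ z.1 z.2) x) ξ - Q') ^ 2) ∂(noiseLaw p)
        ≤ ENNReal.ofReal (1 + B / p) * ENNReal.ofReal ((cosineSim x ξ - Q) ^ 2)
          + ENNReal.ofReal (B * (δ ^ 2 + 1 / p) / p) := by
  obtain ⟨B, hB, h⟩ := exists_lyapunov_step τ ω noiseMoment L hτ hω noiseMoment_nonneg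
  refine ⟨B, hB, fun p x ξ δ Q Q' hp hx hξ hδ hδ1 hQ1 hQ2 => ?_⟩
  have hp0 : (0 : ℝ) < p := by positivity
  have hr : |(Real.sqrt (ω / p) * ‖ξ‖) ^ 2 - ω| ≤ ω * δ := by
    have e : (Real.sqrt (ω / p) * ‖ξ‖) ^ 2 - ω = ω * (‖ξ‖ ^ 2 / p - 1) := by
      rw [mul_pow, Real.sq_sqrt (by positivity)]; ring
    rw [e, abs_mul, abs_of_pos hω]
    gcongr
  have hnorm : ∀ {y : EuclideanSpace ℝ (Fin p)}, y ≠ 0 → ‖‖y‖⁻¹ • y‖ = 1 := fun hy =>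
    norm_smul_inv_norm (𝕜 := ℝ) hy
  have H := stepNoise_noiseLaw hp (hnorm hx) (hnorm hξ)
  rw [← cosineSim_eq_inner] at H
  obtain ⟨h1, h2⟩ := h (noiseLaw p) _ _ _ _ p _ _ δ Q Q' H hr hδ1 hQ1 hQ2
  simp only [cosineSim_ojaStep hp hτ.le hx hξ]
  rw [← ofReal_integral_eq_lintegral_ofReal h1 (ae_of_all _ fun z => sq_nonneg _),
    ← ENNReal.ofReal_mul (by positivity), ← ENNReal.ofReal_add (by positivity) (by positivity)]
  exact ENNReal.ofReal_le_ofReal h2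

/-- The probability that the cosine similarity leaves a neighbourhood of the solution of the
differential equation, on the event that the initial data are within `δ` of their limits. -/
theorem exists_run_bound (τ ω : ℝ) (hτ : 0 < τ) (hω : 0 < ω) {T q₀ : ℝ} (hT : 0 ≤ T) {Q : ℝ → ℝ}
    (hQ : SolvesOjaODE (τ * ω * (1 + τ / 2)) (τ * (ω - τ / 2)) q₀ Q) :
    ∃ B, 0 ≤ B ∧ ∀ (p : ℕ) (m : Measure (RunData p)) [IsProbabilityMeasure m] (δ l : ℝ), 1 ≤ p →
      RunData.FreshNoise m → 0 ≤ δ → δ ≤ 1 → δ < |q₀| → 0 < l →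
      m {w | w ∈ {w : RunData p | |‖w.1.2‖ ^ 2 / p - 1| ≤ δ ∧ |RunData.cosine τ ω 0 w - q₀| ≤ δ}
        ∧ ∃ k ≤ ⌊(p : ℝ) * T⌋₊, l ≤ (RunData.cosine τ ω k w - Q (k / p)) ^ 2}
      ≤ ENNReal.ofReal (Real.exp (B * T) * (δ ^ 2 + T * (B * (δ ^ 2 + 1 / p))) / l) := by
  obtain ⟨L, hL, hQ1, hQ2⟩ := hQ.exists_euler_error T
  obtain ⟨B, hB, hstep⟩ := exists_lintegral_ojaStep_le τ ω L hτ hω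
  refine ⟨B, hB, fun p m _ δ l hp hm hδ hδ1 hδq hl => ?_⟩
  have hp0 : (0 : ℝ) < p := by positivity
  set G : Set (RunData p) :=
    {w | |‖w.1.2‖ ^ 2 / p - 1| ≤ δ ∧ |RunData.cosine τ ω 0 w - q₀| ≤ δ} with hGdef
  set n := ⌊(p : ℝ) * T⌋₊ with hn
  have hnT : (n : ℝ) ≤ p * T := Nat.floor_le (by positivity)
  set V : ℕ → RunData p → ENNReal := fun k w =>
    ENNReal.ofReal ((RunData.cosine τ ω k w - Q (k / p)) ^ 2) with hVdef
  have hV : ∀ k, Measurable (V k) := fun k => by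
    have := RunData.measurable_cosine (p := p) τ ω k
    exact (by fun_prop : Measurable fun w => (RunData.cosine τ ω k w - Q (k / p)) ^ 2).ennreal_ofReal
  have hG : MeasurableSet G := by
    have := RunData.measurable_cosine (p := p) τ ω 0
    have h1 : Measurable fun w : RunData p => |‖w.1.2‖ ^ 2 / p - 1| := by fun_prop
    have h2 : Measurable fun w : RunData p => |RunData.cosine τ ω 0 w - q₀| := by fun_prop
    exact (measurableSet_le h1 measurable_const).inter (measurableSet_le h2 measurable_const)
  -- close to their limits, the initial vectors do not vanish
  have hne : ∀ w ∈ G, w.1.1 ≠ 0 ∧ w.1.2 ≠ 0 := fun w hw => by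
    have h0 : RunData.cosine τ ω 0 w ≠ 0 := fun h => by
      have := hw.2
      rw [h, zero_sub, abs_neg] at this
      linarith
    constructor
    · intro h
      apply h0
      rw [RunData.cosine_zero, cosineSim, h, inner_zero_left, zero_div]
    · intro h
      apply h0
      rw [RunData.cosine_zero, cosineSim, h, inner_zero_right, zero_div]
  have hmax := maximal_inequality (μ := m) hV hG (l := ENNReal.ofReal l)
    (β := ENNReal.ofReal (1 + B / p)) (κ := ENNReal.ofReal (B * (δ ^ 2 + 1 / p) / p))
    (by rw [← ENNReal.ofReal_one]; exact ENNReal.ofReal_le_ofReal (by simp; positivity)) (n := n) ?_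
  · have e : {w | w ∈ G ∧ ∃ k ≤ n, l ≤ (RunData.cosine τ ω k w - Q (k / p)) ^ 2}
        = {w | w ∈ G ∧ ∃ k ≤ n, ENNReal.ofReal l ≤ V k w} := by
      ext w
      simp only [Set.mem_ofPred_eq, hVdef, ENNReal.ofReal_le_ofReal_iff (sq_nonneg _)]
    rw [e, ENNReal.ofReal_div_of_pos hl, ENNReal.le_div_iff_mul_le
      (Or.inl (ENNReal.ofReal_pos.2 hl).ne') (Or.inl ENNReal.ofReal_ne_top), mul_comm]
    refine hmax.trans ?_
    have h0 : ∫⁻ w in G, V 0 w ∂m ≤ ENNReal.ofReal (δ ^ 2) := by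
      calc ∫⁻ w in G, V 0 w ∂m ≤ ∫⁻ _ in G, ENNReal.ofReal (δ ^ 2) ∂m := by
            refine setLIntegral_mono measurable_const fun w hw => ENNReal.ofReal_le_ofReal ?_
            have := hw.2
            rw [← sq_abs]
            simp only [Nat.cast_zero, zero_div, hQ.1]
            exact pow_le_pow_left₀ (abs_nonneg _) this 2
        _ = ENNReal.ofReal (δ ^ 2) * m G := setLIntegral_const _ _
        _ ≤ ENNReal.ofReal (δ ^ 2) * 1 := by gcongr; exact prob_le_one
        _ = _ := mul_one _
    calc ENNReal.ofReal (1 + B / p) ^ n * (∫⁻ w in G, V 0 w ∂m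
          + n * ENNReal.ofReal (B * (δ ^ 2 + 1 / p) / p))
        ≤ ENNReal.ofReal (1 + B / p) ^ n * (ENNReal.ofReal (δ ^ 2)
          + n * ENNReal.ofReal (B * (δ ^ 2 + 1 / p) / p)) := by gcongr
      _ = ENNReal.ofReal ((1 + B / p) ^ n * (δ ^ 2 + n * (B * (δ ^ 2 + 1 / p) / p))) := by
        rw [ENNReal.ofReal_mul (by positivity),
          ENNReal.ofReal_pow (by positivity : 0 ≤ 1 + B / (p : ℝ)),
          ENNReal.ofReal_add (sq_nonneg δ) (by positivity), ENNReal.ofReal_mul n.cast_nonneg,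
          ENNReal.ofReal_natCast]
      _ ≤ _ := by
        apply ENNReal.ofReal_le_ofReal
        have hexp : (1 + B / p) ^ n ≤ Real.exp (B * T) := by
          calc (1 + B / p) ^ n ≤ Real.exp (B / p) ^ n := by
                gcongr
                linarith [Real.add_one_le_exp (B / p)]
            _ = Real.exp (n * (B / p)) := (Real.exp_nat_mul _ _).symm
            _ ≤ Real.exp (B * T) := by
                apply Real.exp_le_exp.2
                calc (n : ℝ) * (B / p) ≤ (p * T) * (B / p) := by gcongr
                  _ = B * T := by field_simp
        have hsum : (n : ℝ) * (B * (δ ^ 2 + 1 / p) / p) ≤ T * (B * (δ ^ 2 + 1 / p)) := by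
          calc (n : ℝ) * (B * (δ ^ 2 + 1 / p) / p) ≤ (p * T) * (B * (δ ^ 2 + 1 / p) / p) := by gcongr
            _ = _ := by field_simp
        gcongr
  · intro k hk
    set D : Set (RunData p) := {w | w ∈ G ∧ ∀ j ≤ k, V j w < ENNReal.ofReal l} with hDdef
    have hD : MeasurableSet D := by
      have : D = G ∩ ⋂ j ≤ k, {w | V j w < ENNReal.ofReal l} := by
        ext w; simp [hDdef]
      rw [this]
      exact hG.inter (MeasurableSet.iInter fun j => MeasurableSet.iInter fun _ =>
        measurableSet_lt (hV j) measurable_const)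
    -- membership in `D` is decided by the past
    have hDpast : ∀ w, w.past k ∈ D ↔ w ∈ D := fun w => by
      have e1 : ∀ j ≤ k, V j (w.past k) = V j w := fun j hj => by
        simp only [hVdef, RunData.cosine_past τ ω hj]
      have e2 : w.past k ∈ G ↔ w ∈ G := by
        simp only [hGdef, Set.mem_ofPred_eq, RunData.cosine_past τ ω (Nat.zero_le k),
          RunData.past_fst]
      simp only [hDdef, Set.mem_ofPred_eq, e2]
      refine and_congr_right fun _ => forall₂_congr fun j hj => ?_
      rw [e1 j hj]
    have hk1 : ((k : ℝ) + 1) / p ≤ T := by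
      rw [div_le_iff₀ hp0]
      have : ((k + 1 : ℕ) : ℝ) ≤ n := by exact_mod_cast hk
      push_cast at this
      linarith
    have hstepk : ((k + 1 : ℕ) : ℝ) / p - k / p = 1 / p := by push_cast; ring
    have hk0 : (0 : ℝ) ≤ k / p := by positivity
    have hkk : (k : ℝ) / p ≤ ((k + 1 : ℕ) : ℝ) / p := by
      have : (0 : ℝ) ≤ 1 / p := by positivity
      linarith
    have hkT : ((k + 1 : ℕ) : ℝ) / p ≤ T := by push_cast; exact hk1
    have hL1 : |Q (((k + 1 : ℕ) : ℝ) / p) - Q (k / p)| ≤ L / p := by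
      refine (hQ1 _ ⟨hk0, hkk.trans hkT⟩ _ ⟨hk0.trans hkk, hkT⟩).trans (le_of_eq ?_)
      rw [hstepk, abs_of_nonneg (by positivity)]
      ring
    have hL2 : |Q (((k + 1 : ℕ) : ℝ) / p) - Q (k / p)
        - (-(τ * ω * (1 + τ / 2)) * Q (k / p) ^ 3 + τ * (ω - τ / 2) * Q (k / p)) / p|
        ≤ L / (p : ℝ) ^ 2 := by
      have := hQ2 _ _ hk0 hkk hkT
      rw [hstepk] at this
      calc _ = _ := by congr 1; ring
        _ ≤ _ := this
        _ = _ := by ring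
    have hle : ∀ w ∈ D, ∫⁻ z, ENNReal.ofReal ((RunData.nextStep τ ω k w z
        - Q (((k + 1 : ℕ) : ℝ) / p)) ^ 2) ∂(noiseLaw p)
        ≤ ENNReal.ofReal (1 + B / p) * V k w + ENNReal.ofReal (B * (δ ^ 2 + 1 / p) / p) := by
      intro w hw
      obtain ⟨hx, hξ⟩ := hne w hw.1
      exact hstep p (RunData.iter τ ω k w) w.1.2 δ _ _ hp
        (RunData.iter_ne_zero hp hτ.le ω hx k) hξ hw.1.1 hδ1 hL1 hL2
    calc ∫⁻ w in D, V (k + 1) w ∂m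
        ≤ ∫⁻ w in D, (ENNReal.ofReal (1 + B / p) * V k w
          + ENNReal.ofReal (B * (δ ^ 2 + 1 / p) / p)) ∂m :=
          hm.setLIntegral_cosine_succ_le hD hDpast hle
      _ = ENNReal.ofReal (1 + B / p) * ∫⁻ w in D, V k w ∂m
          + ENNReal.ofReal (B * (δ ^ 2 + 1 / p) / p) * m D := by
          rw [lintegral_add_right _ measurable_const, lintegral_const_mul _ (hV k),
            setLIntegral_const]
      _ ≤ ENNReal.ofReal (1 + B / p) * ∫⁻ w in D, V k w ∂m
          + ENNReal.ofReal (B * (δ ^ 2 + 1 / p) / p) * 1 := by gcongr; exact prob_le_one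
      _ = _ := by rw [mul_one]

end

theorem proposition2
    (τ ω ρ : ℝ) (hτ : 0 < τ) (hω : 0 < ω) (hρ : 0 < ρ) (hρ1 : ρ ≤ 1)
    (u : Measure ℝ) [IsProbabilityMeasure u]
    (hu_int : Integrable (fun x : ℝ => x ^ 2) u) (hu : ∫ x, x ^ 2 ∂u = 1 / ρ)
    (Ω : ℕ → Type*) [∀ p, MeasurableSpace (Ω p)]
    (P : ∀ p, Measure (Ω p)) [∀ p, IsProbabilityMeasure (P p)]
    (ξ x₀ : ∀ p, Ω p → EuclideanSpace ℝ (Fin p))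
    (c : ∀ p, ℕ → Ω p → ℝ) (a : ∀ p, ℕ → Ω p → EuclideanSpace ℝ (Fin p))
    (hmodel : ∀ p, IsSpikedModel (P p) p (sparsePrior ρ u) (ξ p) (x₀ p) (c p) (a p))
    (Q₀ : ℝ) (hQ₀ : Q₀ ≠ 0)
    (hinit : ∀ ε : ℝ, 0 < ε →
      Tendsto (fun p => P p {s | ε ≤ |cosineSim (x₀ p s) (ξ p s) - Q₀|}) atTop (𝓝 0))
    (α₁ α₂ : ℝ) (hα₁ : α₁ = τ * ω * (1 + τ / 2)) (hα₂ : α₂ = τ * (ω - τ / 2)) :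
    ∃ Q : ℝ → ℝ,
      -- `Q` is the unique solution of the initial value problem
      SolvesOjaODE α₁ α₂ Q₀ Q ∧
      (∀ r : ℝ → ℝ, SolvesOjaODE α₁ α₂ Q₀ r → ∀ t, 0 ≤ t → r t = Q t) ∧
      -- its closed form
      (∀ t, 0 ≤ t → Q t ^ 2 =
        if α₂ ≠ 0 then α₂ * (α₁ + (α₂ / Q₀ ^ 2 - α₁) * Real.exp (-2 * α₂ * t))⁻¹
        else (2 * α₁ * t + (Q₀ ^ 2)⁻¹)⁻¹) ∧
      -- convergence in probability, uniformly on compact time intervals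
      (∀ T : ℝ, 0 < T → ∀ ε : ℝ, 0 < ε →
        Tendsto (fun p => P p {s | ∃ t ∈ Set.Icc (0 : ℝ) T,
          ε ≤ |ojaCosine p τ ω (ξ p s) (x₀ p s) (fun k => c p k s) (fun k => a p k s) t - Q t|})
          atTop (𝓝 0)) := by
  have hα₁0 : 0 < α₁ := by rw [hα₁]; positivity
  have hQ := solvesOjaODE_limitCosine α₂ hα₁0 hQ₀
  refine ⟨limitCosine α₁ α₂ Q₀, hQ, fun r hr t ht => hQ.unique hα₁0.le hr ht,
    fun t ht => limitCosine_sq_eq α₂ hα₁0 hQ₀ ht, fun T hT ε hε => ?_⟩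
  generalize limitCosine α₁ α₂ Q₀ = Q at hQ
  obtain ⟨L, hL, hQ1, -⟩ := hQ.exists_euler_error T
  rw [hα₁, hα₂] at hQ
  obtain ⟨B, hB, hbound⟩ := exists_run_bound τ ω hτ hω hT.le hQ
  have := isProbabilityMeasure_sparsePrior hρ.le hρ1 u
  have hlln := fun {δ : ℝ} (hδ : 0 < δ) => tendsto_measure_norm_sq_div_sub_one (P := P)
    (integrable_sq_sparsePrior ρ hu_int) (integral_sq_sparsePrior hρ hu_int hu)
    (fun p => (hmodel p).measurable_ξ) (fun p => (hmodel p).ξ_law) (fun p => (hmodel p).ξ_indep) hδ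
  -- the bound on the probability, for fixed `δ` and large `p`
  have hmain : ∀ δ : ℝ, 0 < δ → δ ≤ 1 → δ < |Q₀| → ∀ p : ℕ, 1 ≤ p → L / p < ε / 2 →
      P p {s | ∃ t ∈ Set.Icc (0 : ℝ) T,
          ε ≤ |ojaCosine p τ ω (ξ p s) (x₀ p s) (fun k => c p k s) (fun k => a p k s) t - Q t|}
      ≤ P p {s | δ ≤ |‖ξ p s‖ ^ 2 / p - 1|} + P p {s | δ ≤ |cosineSim (x₀ p s) (ξ p s) - Q₀|}
        + ENNReal.ofReal (Real.exp (B * T) * (δ ^ 2 + T * (B * (δ ^ 2 + 1 / p))) / (ε / 2) ^ 2) := by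
    intro δ hδ hδ1 hδq p hp hLp
    have hp0 : (0 : ℝ) < p := by positivity
    obtain ⟨mZ, hfresh⟩ := (hmodel p).freshNoise
    obtain ⟨Z, hZ⟩ : ∃ Z : Ω p → RunData p,
      Z = fun s => ((x₀ p s, ξ p s), fun k => (c p k s, a p k s)) := ⟨_, rfl⟩
    rw [← hZ] at mZ hfresh
    have := Measure.isProbabilityMeasure_map (μ := P p) mZ.aemeasurable
    have hb := hbound p ((P p).map Z) δ ((ε / 2) ^ 2) hp hfresh hδ.le hδ1 hδq (by positivity)
    refine le_trans ?_ (add_le_add_right ((Measure.le_map_apply mZ.aemeasurable _).trans hb) _)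
    refine le_trans (measure_mono ?_) ((measure_union_le _ _).trans
      (add_le_add_left (measure_union_le _ _) _))
    rintro s ⟨t, ⟨ht0, htT⟩, hst⟩
    by_cases h1 : δ ≤ |‖ξ p s‖ ^ 2 / p - 1|
    · exact Or.inl (Or.inl h1)
    by_cases h2 : δ ≤ |cosineSim (x₀ p s) (ξ p s) - Q₀|
    · exact Or.inl (Or.inr h2)
    push Not at h1 h2
    refine Or.inr ?_
    -- at the grid time `k / p` just before `t` the distance is still at least `ε / 2`
    have hk := Nat.floor_le (by positivity : 0 ≤ (p : ℝ) * t)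
    have hk' := Nat.lt_floor_add_one ((p : ℝ) * t)
    set k := ⌊(p : ℝ) * t⌋₊ with hkdef
    have hkt : (k : ℝ) / p ≤ t := by rw [div_le_iff₀ hp0]; linarith
    have hkt' : t - k / p ≤ 1 / p := by
      rw [sub_le_iff_le_add, ← add_div, le_div_iff₀ hp0]; linarith
    have hQk : |Q t - Q (k / p)| < ε / 2 := by
      refine (hQ1 _ ⟨by positivity, hkt.trans htT⟩ _ ⟨ht0, htT⟩).trans_lt (lt_of_le_of_lt ?_ hLp)
      rw [abs_of_nonneg (by linarith), div_eq_mul_one_div L]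
      gcongr
    have hcos : ojaCosine p τ ω (ξ p s) (x₀ p s) (fun k => c p k s) (fun k => a p k s) t
        = RunData.cosine τ ω k (Z s) := by rw [hZ]; rfl
    rw [hcos] at hst
    have hG1 : (Z s).1.2 = ξ p s := by rw [hZ]
    have hG2 : RunData.cosine τ ω 0 (Z s) = cosineSim (x₀ p s) (ξ p s) := by rw [hZ]; rfl
    refine ⟨⟨by rw [hG1]; exact h1.le, by rw [hG2]; exact h2.le⟩, k,
      Nat.floor_le_floor (by gcongr), ?_⟩
    rw [← sq_abs (RunData.cosine τ ω k (Z s) - Q (k / p))]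
    refine pow_le_pow_left₀ (by positivity) ?_ 2
    have := abs_sub_le (RunData.cosine τ ω k (Z s)) (Q (k / p)) (Q t)
    rw [abs_sub_comm (Q (k / p)) (Q t)] at this
    linarith
  -- the limits as `p → ∞`, for fixed `δ`, and then as `δ → 0`
  obtain ⟨f, hf⟩ : ∃ f : ℝ → ℕ → ENNReal, f = fun δ p =>
      P p {s | δ ≤ |‖ξ p s‖ ^ 2 / p - 1|} + P p {s | δ ≤ |cosineSim (x₀ p s) (ξ p s) - Q₀|}
        + ENNReal.ofReal (Real.exp (B * T) * (δ ^ 2 + T * (B * (δ ^ 2 + 1 / p))) / (ε / 2) ^ 2) :=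
    ⟨_, rfl⟩
  have hinv : Tendsto (fun p : ℕ => 1 / (p : ℝ)) atTop (𝓝 0) := tendsto_one_div_atTop_nhds_zero_nat
  have hlim : ∀ δ : ℝ, 0 < δ → Tendsto (f δ) atTop (𝓝 (ENNReal.ofReal
      (Real.exp (B * T) * (δ ^ 2 + T * (B * δ ^ 2)) / (ε / 2) ^ 2))) := fun δ hδ => by
    have h1 : Tendsto (fun p : ℕ => Real.exp (B * T) * (δ ^ 2 + T * (B * (δ ^ 2 + 1 / (p : ℝ))))
        / (ε / 2) ^ 2) atTop
        (𝓝 (Real.exp (B * T) * (δ ^ 2 + T * (B * (δ ^ 2 + 0))) / (ε / 2) ^ 2)) :=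
      (((((hinv.const_add _).const_mul _).const_mul _).const_add _).const_mul _).div_const _
    rw [add_zero] at h1
    have h2 := ((hlln hδ).add (hinit δ hδ)).add (ENNReal.tendsto_ofReal h1)
    rw [add_zero, zero_add] at h2
    rw [hf]
    exact h2
  have hlim0 : Tendsto (fun δ : ℝ => ENNReal.ofReal
      (Real.exp (B * T) * (δ ^ 2 + T * (B * δ ^ 2)) / (ε / 2) ^ 2)) (𝓝[>] 0) (𝓝 0) := by
    have h1 : Continuous (fun δ : ℝ => ENNReal.ofReal
        (Real.exp (B * T) * (δ ^ 2 + T * (B * δ ^ 2)) / (ε / 2) ^ 2)) :=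
      ENNReal.continuous_ofReal.comp (by fun_prop)
    have h2 := (h1.tendsto 0).mono_left (nhdsWithin_le_nhds (s := Set.Ioi 0))
    simpa using h2
  have hεL : ∀ᶠ p : ℕ in atTop, L / p < ε / 2 := by
    have h1 : Tendsto (fun p : ℕ => L / (p : ℝ)) atTop (𝓝 0) := tendsto_const_div_atTop_nhds_zero_nat L
    exact h1.eventually (gt_mem_nhds (by positivity))
  rw [ENNReal.tendsto_nhds_zero]
  intro η hη
  obtain ⟨δ, hδη, hδ0, hδ1⟩ := ((hlim0.eventually (gt_mem_nhds hη)).and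
    (Ioo_mem_nhdsGT (lt_min one_pos (abs_pos.2 hQ₀)))).exists
  filter_upwards [(hlim δ hδ0).eventually (gt_mem_nhds hδη), hεL, eventually_ge_atTop 1]
    with p h1 h2 h3
  refine (hmain δ hδ0 (hδ1.le.trans (min_le_left _ _)) (hδ1.trans_le (min_le_right _ _)) p h3
    h2).trans ?_
  rw [hf] at h1
  exact h1.le
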